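/- Let $\mathcal Z$ be a separable complex Hilbert space, with inner product antilinear in the first variable and norm $|\cdot|$, and let $\Gamma_s(\mathcal Z)=\bigoplus_{n\ge 0}\mathcal S_n\mathcal Z^{\otimes n}$ be the symmetric Fock space over $\mathcal Z$, where $\mathcal S_n$ is the symmetrization projection on the Hilbert tensor power $\mathcal Z^{\otimes n}$. Let $\Gamma_s^{\rm fin}(\mathcal Z)$ be the subspace of vectors with finitely many non-zero components. For $0<\varepsilon\le 1$ and $u\in\mathcal Z$ let $$a^*_\varepsilon(u)\big|_{\mathcal S_n\mathcal Z^{\otimes n}}=\sqrt{\varepsilon(n+1)}\,\mathcal S_{n+1}(|u\rangle\otimes 1),\qquad a_\varepsilon(u)\big|_{\mathcal S_n\mathcal Z^{\otimes n}}=\sqrt{\varepsilon n}\,\mathcal S_{n-1}(\langle u|\otimes 1),$$ let the Segal field operator $\Phi_\varepsilon(u)$ be the closure of $\frac1{\sqrt2}\big(a^*_\varepsilon(u)+a_\varepsilon(u)\big)$ on $\Gamma_s^{\rm fin}(\mathcal Z)$, which is self-adjoint, and let $W_\varepsilon(u)=e^{i\Phi_\varepsilon(u)}$ be the Weyl operator.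 Let $N_1$ be the number operator (multiplication by $n$ on the $n$-particle sector), and for $z\in\mathbb C$ let $(N_1+1)^z$ be the closure of the operator on $\Gamma_s^{\rm fin}(\mathcal Z)$ that multiplies the $n$-particle sector by $(n+1)^z$, with domain $D\big((N_1+1)^z\big)$. Then there is a function $M:\mathbb R\to\mathbb R$ such that for all $z\in\mathbb C$ with $\operatorname{Re}z\ge 0$, all $u\in\mathcal Z\setminus\{0\}$ and all $0<\varepsilon\le 1$: the unitary group generated by $\Phi_\varepsilon(u)$ (hence $W_\varepsilon(u)$) exists, $W_\varepsilon(u)$ maps $D\big((N_1+1)^z\big)$ into itself, the operator $(N_1+1)^z\,W_\varepsilon(u)\,(N_1+1)^{-z}$ is everywhere defined and bounded on $\Gamma_s(\mathcal Z)$, and $$\big\|(N_1+1)^z\,W_\varepsilon(u)\,(N_1+1)^{-z}\big\|\le M(|u|)\,|u|^{\operatorname{Re}z}\,2^{(\operatorname{Re}z)^2}.$$ In particular, $M(|u|)$ depends neither on $\varepsilon$ nor on $z$. -/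

import Mathlib

open scoped TensorProduct ComplexConjugate InnerProductSpace

noncomputable section

namespace Fock

/-! ### The algebraic tensor power with its Hermitian form -/

section AlgTensor

variable (Z : Type*) [NormedAddCommGroup Z] [InnerProductSpace ℂ Z] (n : ℕ)

/-- The algebraic tensor power `Z ⊗ ⋯ ⊗ Z` (`n` factors), as a type of its own so that it can carry
the Hilbert tensor norm instead of the projective one. -/
def AlgTensor : Type _ := ⨂[ℂ] (_ : Fin n), Z

instance : AddCommGroup (AlgTensor Z n) := inferInstanceAs (AddCommGroup (⨂[ℂ] (_ : Fin n), Z))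
instance : Module ℂ (AlgTensor Z n) := inferInstanceAs (Module ℂ (⨂[ℂ] (_ : Fin n), Z))

end AlgTensor

variable {Z : Type*} [NormedAddCommGroup Z] [InnerProductSpace ℂ Z] {n : ℕ}

/-- The elementary tensor `v₁ ⊗ ⋯ ⊗ vₙ`. -/
def elem (n : ℕ) : MultilinearMap ℂ (fun _ : Fin n => Z) (AlgTensor Z n) :=
  PiTensorProduct.tprod ℂ

/-- The linear map on the tensor power induced by a multilinear map. -/
def liftT {E : Type*} [AddCommGroup E] [Module ℂ E]
    (f : MultilinearMap ℂ (fun _ : Fin n => Z) E) : AlgTensor Z n →ₗ[ℂ] E :=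
  PiTensorProduct.lift f

@[simp] theorem liftT_elem {E : Type*} [AddCommGroup E] [Module ℂ E]
    (f : MultilinearMap ℂ (fun _ : Fin n => Z) E) (v : Fin n → Z) : liftT f (elem n v) = f v :=
  PiTensorProduct.lift.tprod v

theorem span_elem : Submodule.span ℂ (Set.range (elem (Z := Z) n)) = ⊤ :=
  PiTensorProduct.span_tprod_eq_top

theorem hom_ext {E : Type*} [AddCommGroup E] [Module ℂ E] {f g : AlgTensor Z n →ₗ[ℂ] E}
    (h : ∀ v, f (elem n v) = g (elem n v)) : f = g :=
  PiTensorProduct.ext (MultilinearMap.ext h)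

theorem elem_induction {p : AlgTensor Z n → Prop} (x : AlgTensor Z n)
    (h : ∀ v, p (elem n v)) (h0 : p 0) (ha : ∀ x y, p x → p y → p (x + y))
    (hs : ∀ (c : ℂ) x, p x → p (c • x)) : p x := by
  have hx : x ∈ Submodule.span ℂ (Set.range (elem (Z := Z) n)) := by
    rw [span_elem]; trivial
  induction hx using Submodule.span_induction with
  | mem x hx => obtain ⟨v, rfl⟩ := hx; exact h v
  | zero => exact h0
  | add x y _ _ hx hy => exact ha x y hx hy
  | smul c x _ hx => exact hs c x hx

/-- The linear functional `v₁ ⊗ ⋯ ⊗ vₙ ↦ ∏ᵢ ⟨uᵢ, vᵢ⟩`. -/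
def pairL (u : Fin n → Z) : AlgTensor Z n →ₗ[ℂ] ℂ :=
  liftT ((MultilinearMap.mkPiAlgebra ℂ (Fin n) ℂ).compLinearMap (fun i => innerₛₗ ℂ (u i)))

@[simp] theorem pairL_elem (u v : Fin n → Z) : pairL u (elem n v) = ∏ i, ⟪u i, v i⟫_ℂ := by
  simp [pairL]

theorem pairL_update_add [DecidableEq (Fin n)] (u : Fin n → Z) (i : Fin n) (a b : Z) :
    pairL (Function.update u i (a + b))
      = pairL (Function.update u i a) + pairL (Function.update u i b) := by
  refine hom_ext fun v => ?_
  simp only [LinearMap.add_apply, pairL_elem]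
  rw [← Finset.mul_prod_erase _ _ (Finset.mem_univ i), ← Finset.mul_prod_erase _ _ (Finset.mem_univ i),
    ← Finset.mul_prod_erase _ _ (Finset.mem_univ i)]
  have h : ∀ c : Z, ∏ j ∈ Finset.univ.erase i, ⟪Function.update u i c j, v j⟫_ℂ
      = ∏ j ∈ Finset.univ.erase i, ⟪u j, v j⟫_ℂ := fun c =>
    Finset.prod_congr rfl fun j hj => by rw [Function.update_of_ne (Finset.ne_of_mem_erase hj)]
  rw [h, h, h]
  simp [add_mul]

theorem pairL_update_smul [DecidableEq (Fin n)] (u : Fin n → Z) (i : Fin n) (c : ℂ) (a : Z) :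
    pairL (Function.update u i (c • a)) = conj c • pairL (Function.update u i a) := by
  refine hom_ext fun v => ?_
  simp only [LinearMap.smul_apply, pairL_elem]
  rw [← Finset.mul_prod_erase _ _ (Finset.mem_univ i), ← Finset.mul_prod_erase _ _ (Finset.mem_univ i)]
  have h : ∀ c : Z, ∏ j ∈ Finset.univ.erase i, ⟪Function.update u i c j, v j⟫_ℂ
      = ∏ j ∈ Finset.univ.erase i, ⟪u j, v j⟫_ℂ := fun c =>
    Finset.prod_congr rfl fun j hj => by rw [Function.update_of_ne (Finset.ne_of_mem_erase hj)]
  rw [h, h]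
  simp [mul_left_comm, mul_assoc]

/-- The Hermitian form on the tensor power, antilinear in the first argument, determined by
`⟨u₁ ⊗ ⋯ ⊗ uₙ, v₁ ⊗ ⋯ ⊗ vₙ⟩ = ∏ᵢ ⟨uᵢ, vᵢ⟩`. -/
def form (x y : AlgTensor Z n) : ℂ :=
  conj (liftT
    { toFun := fun u => conj (pairL u y)
      map_update_add' := fun u i a b => by simp [pairL_update_add]
      map_update_smul' := fun u i c a => by simp [pairL_update_smul] } x)

theorem form_elem_left (u : Fin n → Z) (y : AlgTensor Z n) : form (elem n u) y = pairL u y := by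
  simp [form]

@[simp] theorem form_elem (u v : Fin n → Z) :
    form (elem n u) (elem n v) = ∏ i, ⟪u i, v i⟫_ℂ := by
  rw [form_elem_left, pairL_elem]

theorem form_add_left (x x' y : AlgTensor Z n) : form (x + x') y = form x y + form x' y := by
  simp [form]

theorem form_smul_left (c : ℂ) (x y : AlgTensor Z n) : form (c • x) y = conj c * form x y := by
  simp [form]

theorem form_zero_left (y : AlgTensor Z n) : form 0 y = 0 := by simp [form]

theorem form_add_right (x y y' : AlgTensor Z n) : form x (y + y') = form x y + form x y' := by
  induction x using elem_induction with
  | h v => simp [form_elem_left]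
  | h0 => simp [form_zero_left]
  | ha a b h1 h2 => simp only [form_add_left, h1, h2]; ring
  | hs c a h => simp only [form_smul_left, h]; ring

theorem form_smul_right (c : ℂ) (x y : AlgTensor Z n) : form x (c • y) = c * form x y := by
  induction x using elem_induction with
  | h v => simp [form_elem_left]
  | h0 => simp [form_zero_left]
  | ha a b h1 h2 => simp only [form_add_left, h1, h2]; ring
  | hs d a h => simp only [form_smul_left, h]; ring

theorem form_zero_right (x : AlgTensor Z n) : form x 0 = 0 := by
  simpa using form_smul_right 0 x 0

theorem form_conj_symm (x y : AlgTensor Z n) : conj (form y x) = form x y := by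
  induction x using elem_induction with
  | h v =>
    induction y using elem_induction with
    | h w => simp
    | h0 => simp [form_zero_left, form_zero_right]
    | ha a b h1 h2 => rw [form_add_left, form_add_right, map_add, h1, h2]
    | hs c a h => rw [form_smul_left, form_smul_right, map_mul, h]; simp
  | h0 => simp [form_zero_left, form_zero_right]
  | ha a b h1 h2 => rw [form_add_left, form_add_right, map_add, h1, h2]
  | hs c a h => rw [form_smul_left, form_smul_right, map_mul, h]

theorem form_sum_left {ι : Type*} (s : Finset ι) (f : ι → AlgTensor Z n) (y : AlgTensor Z n) :
    form (∑ k ∈ s, f k) y = ∑ k ∈ s, form (f k) y := by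
  classical
  induction s using Finset.induction_on with
  | empty => simp [form_zero_left]
  | insert a s ha ih => rw [Finset.sum_insert ha, Finset.sum_insert ha, form_add_left, ih]

theorem form_sum_right {ι : Type*} (s : Finset ι) (x : AlgTensor Z n) (f : ι → AlgTensor Z n) :
    form x (∑ k ∈ s, f k) = ∑ k ∈ s, form x (f k) := by
  classical
  induction s using Finset.induction_on with
  | empty => simp [form_zero_right]
  | insert a s ha ih => rw [Finset.sum_insert ha, Finset.sum_insert ha, form_add_right, ih]

open scoped ComplexOrder in
theorem form_self_nonneg (x : AlgTensor Z n) : 0 ≤ RCLike.re (form x x) := by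
  classical
  have hx : x ∈ Submodule.span ℂ (Set.range (elem (Z := Z) n)) := by
    rw [span_elem]; trivial
  obtain ⟨m, c, g, rfl⟩ := Submodule.mem_span_set'.mp hx
  choose w hw using fun k => (g k).2
  have key : ∀ s : Finset (Fin n),
      (Matrix.of fun k l : Fin m => ∏ i ∈ s, ⟪w k i, w l i⟫_ℂ).PosSemidef := by
    intro s
    induction s using Finset.induction_on with
    | empty =>
      have h : (Matrix.of fun k l : Fin m => ∏ i ∈ (∅ : Finset (Fin n)), ⟪w k i, w l i⟫_ℂ)
          = Matrix.gram ℂ (fun _ : Fin m => (1 : ℂ)) := by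
        ext k l; simp [Matrix.gram]
      rw [h]
      exact Matrix.posSemidef_gram ℂ _
    | insert a s ha ih =>
      have h : (Matrix.of fun k l : Fin m => ∏ i ∈ insert a s, ⟪w k i, w l i⟫_ℂ)
          = (Matrix.gram ℂ (fun k : Fin m => w k a)).hadamard
            (Matrix.of fun k l : Fin m => ∏ i ∈ s, ⟪w k i, w l i⟫_ℂ) := by
        ext k l; simp [Matrix.gram, Finset.prod_insert ha]
      rw [h]
      exact (Matrix.posSemidef_gram ℂ _).hadamard ih
  have h := (key Finset.univ).dotProduct_mulVec_nonneg c
  have h2 : form (∑ k, c k • (g k : AlgTensor Z n)) (∑ k, c k • (g k : AlgTensor Z n))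
      = star c ⬝ᵥ (Matrix.of fun k l : Fin m => ∏ i, ⟪w k i, w l i⟫_ℂ).mulVec c := by
    rw [form_sum_left]
    simp only [form_smul_left]
    simp only [form_sum_right, form_smul_right, ← hw, form_elem, dotProduct, Matrix.mulVec, Finset.mul_sum, Matrix.of_apply, Pi.star_apply]
    refine Finset.sum_congr rfl fun k _ => Finset.sum_congr rfl fun l _ => ?_
    simp only [RCLike.star_def]
    ring
  rw [h2]
  exact (RCLike.nonneg_iff.mp h).1

/-- The form is a positive semidefinite Hermitian form. (It is in fact definite; the completion
below is insensitive to this.) -/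
abbrev formCore (Z : Type*) [NormedAddCommGroup Z] [InnerProductSpace ℂ Z] (n : ℕ) :
    PreInnerProductSpace.Core ℂ (AlgTensor Z n) where
  inner := form
  conj_inner_symm x y := form_conj_symm x y
  re_inner_nonneg := form_self_nonneg
  add_left := form_add_left
  smul_left x y c := form_smul_left c x y

instance : SeminormedAddCommGroup (AlgTensor Z n) :=
  @InnerProductSpace.Core.toSeminormedAddCommGroup ℂ (AlgTensor Z n) _ _ _ (formCore Z n)

instance : InnerProductSpace ℂ (AlgTensor Z n) := InnerProductSpace.ofCore (formCore Z n)

theorem inner_eq_form (x y : AlgTensor Z n) : ⟪x, y⟫_ℂ = form x y := rfl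

@[simp] theorem inner_elem (u v : Fin n → Z) :
    ⟪elem n u, elem n v⟫_ℂ = ∏ i, ⟪u i, v i⟫_ℂ := form_elem u v

/-! ### Hilbert tensor powers, symmetrization, Fock space -/

/-- The Hilbert space tensor power of order `n`. -/
abbrev HilbTensor (Z : Type*) [NormedAddCommGroup Z] [InnerProductSpace ℂ Z] (n : ℕ) : Type _ :=
  UniformSpace.Completion (AlgTensor Z n)

/-- Extension of a linear map between algebraic tensor powers that multiplies norms by at most `C`
to the Hilbert tensor powers. -/
def extendT {m : ℕ} (f : AlgTensor Z n →ₗ[ℂ] AlgTensor Z m) (C : ℝ)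
    (h : ∀ x, ‖f x‖ ≤ C * ‖x‖) : HilbTensor Z n →L[ℂ] HilbTensor Z m :=
  ((UniformSpace.Completion.toComplL (𝕜 := ℂ) (E := AlgTensor Z m)).comp
    (f.mkContinuous C h)).extend (UniformSpace.Completion.toComplL (𝕜 := ℂ) (E := AlgTensor Z n))

theorem extendT_coe {m : ℕ} (f : AlgTensor Z n →ₗ[ℂ] AlgTensor Z m) (C : ℝ)
    (h : ∀ x, ‖f x‖ ≤ C * ‖x‖) (x : AlgTensor Z n) :
    extendT f C h (x : HilbTensor Z n) = ((f x : AlgTensor Z m) : HilbTensor Z m) :=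
  ContinuousLinearMap.extend_eq _ (UniformSpace.Completion.denseRange_coe)
    (UniformSpace.Completion.isUniformInducing_coe _) x

/-- Permutation of the tensor factors:
`v₁ ⊗ ⋯ ⊗ vₙ ↦ v_{σ(1)} ⊗ ⋯ ⊗ v_{σ(n)}`. -/
def permAlg (σ : Equiv.Perm (Fin n)) : AlgTensor Z n →ₗ[ℂ] AlgTensor Z n :=
  liftT ((elem n).domDomCongr σ)

@[simp] theorem permAlg_elem (σ : Equiv.Perm (Fin n)) (v : Fin n → Z) :
    permAlg σ (elem n v) = elem n (fun i => v (σ i)) := by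
  simp [permAlg]

theorem inner_permAlg (σ : Equiv.Perm (Fin n)) (x y : AlgTensor Z n) :
    ⟪permAlg σ x, permAlg σ y⟫_ℂ = ⟪x, y⟫_ℂ := by
  induction x using elem_induction with
  | h v =>
    induction y using elem_induction with
    | h w =>
      simp only [permAlg_elem, inner_elem]
      exact Equiv.prod_comp σ (fun i => ⟪v i, w i⟫_ℂ)
    | h0 => simp
    | ha a b h1 h2 => rw [map_add, inner_add_right, inner_add_right, h1, h2]
    | hs c a h => rw [map_smul, inner_smul_right, inner_smul_right, h]
  | h0 => simp
  | ha a b h1 h2 => rw [map_add, inner_add_left, inner_add_left, h1, h2]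
  | hs c a h => rw [map_smul, inner_smul_left, inner_smul_left, h]

theorem norm_permAlg (σ : Equiv.Perm (Fin n)) (x : AlgTensor Z n) : ‖permAlg σ x‖ = ‖x‖ := by
  rw [@norm_eq_sqrt_re_inner ℂ, @norm_eq_sqrt_re_inner ℂ, inner_permAlg]

/-- Permutation of the factors of the Hilbert tensor power. -/
def perm (σ : Equiv.Perm (Fin n)) : HilbTensor Z n →L[ℂ] HilbTensor Z n :=
  extendT (permAlg σ) 1 fun x => by rw [norm_permAlg, one_mul]

/-- The symmetrization projection
`u₁ ⊗ ⋯ ⊗ uₙ ↦ (1/n!) ∑_σ u_{σ(1)} ⊗ ⋯ ⊗ u_{σ(n)}`. -/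
def symmetrize (Z : Type*) [NormedAddCommGroup Z] [InnerProductSpace ℂ Z] (n : ℕ) :
    HilbTensor Z n →L[ℂ] HilbTensor Z n :=
  ((n.factorial : ℂ)⁻¹) • ∑ σ : Equiv.Perm (Fin n), perm σ

/-- The `n`-particle sector: the range of the symmetrization projection. -/
abbrev Sector (Z : Type*) [NormedAddCommGroup Z] [InnerProductSpace ℂ Z] (n : ℕ) :
    Submodule ℂ (HilbTensor Z n) :=
  LinearMap.range (symmetrize Z n).toLinearMap

/-- Symmetrization as a map onto the `n`-particle sector. -/
def symmOnto (Z : Type*) [NormedAddCommGroup Z] [InnerProductSpace ℂ Z] (n : ℕ) :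
    HilbTensor Z n →L[ℂ] Sector Z n :=
  (symmetrize Z n).codRestrict (Sector Z n) fun x => LinearMap.mem_range_self _ x

/-- The symmetric (bosonic) Fock space: the Hilbert direct sum of the `n`-particle sectors. -/
abbrev FockSpace (Z : Type*) [NormedAddCommGroup Z] [InnerProductSpace ℂ Z] : Type _ :=
  lp (fun n : ℕ => Sector Z n) 2

/-- The finite particle space. -/
def finiteParticle (Z : Type*) [NormedAddCommGroup Z] [InnerProductSpace ℂ Z] :
    Submodule ℂ (FockSpace Z) where
  carrier := {ψ | {n : ℕ | ψ n ≠ 0}.Finite}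
  zero_mem' := by simp
  add_mem' {φ ψ} hφ hψ := (hφ.union hψ).subset fun n hn => by
    by_contra h
    simp only [Set.mem_union, Set.mem_ofPred_eq, not_or, not_not] at h
    exact hn (by simp [h.1, h.2])
  smul_mem' c ψ hψ := hψ.subset fun n hn h => hn (by simp [h])

/-- A family of components of which finitely many are non-zero, as a vector of Fock space. -/
def ofFinite (f : ∀ n : ℕ, Sector Z n) (hf : {n : ℕ | f n ≠ 0}.Finite) : FockSpace Z :=
  ⟨f, (memℓp_zero hf).of_exponent_ge zero_le⟩

@[simp] theorem ofFinite_apply (f : ∀ n : ℕ, Sector Z n) (hf : {n : ℕ | f n ≠ 0}.Finite) (n : ℕ) :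
    ofFinite f hf n = f n := rfl

/-! ### Creation, annihilation and field operators -/

/-- The algebraic map `x ↦ u ⊗ x`. -/
def ketAlg (n : ℕ) (u : Z) : AlgTensor Z n →ₗ[ℂ] AlgTensor Z (n + 1) :=
  liftT ((elem (n + 1)).curryLeft u)

@[simp] theorem ketAlg_elem (u : Z) (v : Fin n → Z) :
    ketAlg n u (elem n v) = elem (n + 1) (Fin.cons u v) := by
  simp [ketAlg]

theorem inner_ketAlg (u u' : Z) (x y : AlgTensor Z n) :
    ⟪ketAlg n u x, ketAlg n u' y⟫_ℂ = ⟪u, u'⟫_ℂ * ⟪x, y⟫_ℂ := by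
  induction x using elem_induction with
  | h v =>
    induction y using elem_induction with
    | h w => simp [Fin.prod_univ_succ]
    | h0 => simp
    | ha a b h1 h2 => rw [map_add, inner_add_right, inner_add_right, h1, h2, mul_add]
    | hs c a h => rw [map_smul, inner_smul_right, inner_smul_right, h, mul_left_comm]
  | h0 => simp
  | ha a b h1 h2 => rw [map_add, inner_add_left, inner_add_left, h1, h2, mul_add]
  | hs c a h => rw [map_smul, inner_smul_left, inner_smul_left, h, mul_left_comm]

theorem norm_ketAlg (u : Z) (x : AlgTensor Z n) : ‖ketAlg n u x‖ = ‖u‖ * ‖x‖ := by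
  have h := inner_ketAlg u u x x
  rw [inner_self_eq_norm_sq_to_K, inner_self_eq_norm_sq_to_K, inner_self_eq_norm_sq_to_K] at h
  have h2 : ‖ketAlg n u x‖ ^ 2 = (‖u‖ * ‖x‖) ^ 2 := by
    rw [mul_pow]; exact_mod_cast h
  exact (sq_eq_sq₀ (norm_nonneg _) (by positivity)).mp h2

/-- The operator `|u⟩ ⊗ 1`, i.e. `x ↦ u ⊗ x`, on the Hilbert tensor power. -/
def ket (n : ℕ) (u : Z) : HilbTensor Z n →L[ℂ] HilbTensor Z (n + 1) :=
  extendT (ketAlg n u) ‖u‖ fun x => (norm_ketAlg u x).le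

/-- The operator `⟨u| ⊗ 1 = (|u⟩ ⊗ 1)*`, i.e. `v ⊗ x ↦ ⟨u, v⟩ x`. -/
def bra (n : ℕ) (u : Z) : HilbTensor Z (n + 1) →L[ℂ] HilbTensor Z n :=
  (ket n u).adjoint

theorem bra_elem (u : Z) (v : Fin (n + 1) → Z) :
    bra n u ((elem (n + 1) v : AlgTensor Z (n + 1)) : HilbTensor Z (n + 1))
      = ⟪u, v 0⟫_ℂ • ((elem n (Fin.tail v) : AlgTensor Z n) : HilbTensor Z n) := by
  refine ext_inner_left ℂ fun y => ?_
  rw [bra, ContinuousLinearMap.adjoint_inner_right]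
  induction y using UniformSpace.Completion.induction_on with
  | hp => exact isClosed_eq (by fun_prop) (by fun_prop)
  | ih a =>
    rw [ket, extendT_coe, UniformSpace.Completion.inner_coe, inner_smul_right,
      UniformSpace.Completion.inner_coe]
    have hv : elem (n + 1) v = ketAlg n (v 0) (elem n (Fin.tail v)) := by
      rw [ketAlg_elem, Fin.cons_self_tail]
    rw [hv, inner_ketAlg]

/-- The creation operator from the `n`- to the `(n+1)`-particle sector,
`√(ε (n+1)) S_{n+1} (|u⟩ ⊗ 1)`. -/
def createSector (ε : ℝ) (u : Z) (n : ℕ) : Sector Z n →L[ℂ] Sector Z (n + 1) :=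
  ((√(ε * (n + 1)) : ℝ) : ℂ) • (symmOnto Z (n + 1)).comp ((ket n u).comp (Sector Z n).subtypeL)

/-- The annihilation operator from the `(n+1)`- to the `n`-particle sector,
`√(ε (n+1)) S_n (⟨u| ⊗ 1)`. -/
def annihilateSector (ε : ℝ) (u : Z) (n : ℕ) : Sector Z (n + 1) →L[ℂ] Sector Z n :=
  ((√(ε * (n + 1)) : ℝ) : ℂ) • (symmOnto Z n).comp ((bra n u).comp (Sector Z (n + 1)).subtypeL)

/-- The components of the vector obtained by applying the creation operator. -/
def createComp (ε : ℝ) (u : Z) (ψ : FockSpace Z) : ∀ n : ℕ, Sector Z n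
  | 0 => 0
  | n + 1 => createSector ε u n (ψ n)

theorem createComp_finite (ε : ℝ) (u : Z) (ψ : finiteParticle Z) :
    {n : ℕ | createComp ε u ψ n ≠ 0}.Finite := by
  refine (Set.Finite.image Nat.succ ψ.2).subset fun n hn => ?_
  cases n with
  | zero => exact absurd rfl hn
  | succ n =>
    refine ⟨n, fun h => hn ?_, rfl⟩
    simp [createComp, h]

/-- The `ε`-dependent creation operator on the finite particle space; it vanishes in the `0`-th
component of its values. -/
def create (ε : ℝ) (u : Z) : finiteParticle Z →ₗ[ℂ] FockSpace Z where
  toFun ψ := ofFinite (createComp ε u ψ) (createComp_finite ε u ψ)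
  map_add' φ ψ := by
    ext1; funext n
    cases n <;> simp [createComp]
  map_smul' c ψ := by
    ext1; funext n
    cases n <;> simp [createComp]

theorem annihilateComp_finite (ε : ℝ) (u : Z) (ψ : finiteParticle Z) :
    {n : ℕ | annihilateSector ε u n ((ψ : FockSpace Z) (n + 1)) ≠ 0}.Finite := by
  refine (Set.Finite.preimage (f := Nat.succ) Nat.succ_injective.injOn ψ.2).subset fun n hn h => ?_
  exact hn (by simp [show (ψ : FockSpace Z) (n + 1) = 0 from h])

/-- The `ε`-dependent annihilation operator on the finite particle space; it vanishes on the
vacuum sector. -/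
def annihilate (ε : ℝ) (u : Z) : finiteParticle Z →ₗ[ℂ] FockSpace Z where
  toFun ψ := ofFinite (fun n => annihilateSector ε u n ((ψ : FockSpace Z) (n + 1)))
    (annihilateComp_finite ε u ψ)
  map_add' φ ψ := by
    ext1; funext n
    simp
  map_smul' c ψ := by
    ext1; funext n
    simp

/-- The Segal field operator `Φ_ε(u) = (a*_ε(u) + a_ε(u)) / √2` on the finite particle space. -/
def segalFin (ε : ℝ) (u : Z) : FockSpace Z →ₗ.[ℂ] FockSpace Z where
  domain := finiteParticle Z
  toFun := (((√2)⁻¹ : ℝ) : ℂ) • (create ε u + annihilate ε u)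

/-- The Segal field operator: the closure of its restriction to the finite particle space. -/
def segal (ε : ℝ) (u : Z) : FockSpace Z →ₗ.[ℂ] FockSpace Z := (segalFin ε u).closure

/-! ### Complex powers of `N₁ + 1` -/

theorem numberPow_finite (z : ℂ) (ψ : finiteParticle Z) :
    {n : ℕ | ((n : ℂ) + 1) ^ z • (ψ : FockSpace Z) n ≠ 0}.Finite :=
  Set.Finite.subset ψ.2 fun n hn h => hn (by rw [h, smul_zero])

/-- `(N₁ + 1)^z` on the finite particle space: the number operator `N₁ = dΓ₁(1)` is multiplication
by `n` on the `n`-particle sector. -/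
def numberPowFin (Z : Type*) [NormedAddCommGroup Z] [InnerProductSpace ℂ Z] (z : ℂ) :
    FockSpace Z →ₗ.[ℂ] FockSpace Z where
  domain := finiteParticle Z
  toFun :=
    { toFun := fun ψ => ofFinite (fun n => ((n : ℂ) + 1) ^ z • (ψ : FockSpace Z) n)
        (numberPow_finite z ψ)
      map_add' := fun φ ψ => by ext1; funext n; simp
      map_smul' := fun c ψ => by ext1; funext n; simp [smul_comm c] }

/-- `(N₁ + 1)^z`: the closure of its restriction to the finite particle space. -/
def numberPow (Z : Type*) [NormedAddCommGroup Z] [InnerProductSpace ℂ Z] (z : ℂ) :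
    FockSpace Z →ₗ.[ℂ] FockSpace Z := (numberPowFin Z z).closure

end Fock

/-! ### Unitary groups and Weyl operators -/

namespace Fock

variable {H : Type*} [NormedAddCommGroup H] [InnerProductSpace ℂ H]

/-- `U` is the strongly continuous one-parameter unitary group `t ↦ e^{itA}`: its infinitesimal
generator is `iA`, that is, `x` lies in the domain of `A` with `A x = y` if and only if `t ↦ U t x`
is differentiable at `0` with derivative `i y`. -/
structure IsUnitaryGroup (A : H →ₗ.[ℂ] H) (U : ℝ → H →L[ℂ] H) : Prop where
  map_zero : U 0 = 1
  map_add : ∀ s t, U (s + t) = U s * U t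
  norm_map : ∀ t x, ‖U t x‖ = ‖x‖
  continuous : ∀ x, Continuous fun t => U t x
  mem_graph_iff : ∀ x y, (x, y) ∈ A.graph ↔ HasDerivAt (fun t => U t x) (Complex.I • y) 0

theorem IsUnitaryGroup.hasDerivAt {A : H →ₗ.[ℂ] H} {U : ℝ → H →L[ℂ] H} (hU : IsUnitaryGroup A U)
    {x y : H} (h : (x, y) ∈ A.graph) (t : ℝ) :
    HasDerivAt (fun s => U s x) (Complex.I • U t y) t := by
  have h0 := (hU.mem_graph_iff x y).mp h
  have h1 : HasDerivAt (fun s => U (s - t) x) (Complex.I • y) t := by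
    have : HasDerivAt (fun s => U s x) (Complex.I • y) (t - t) := by rwa [sub_self]
    have h2 := this.scomp t (h := fun s => s - t) ((hasDerivAt_id t).sub_const t)
    rw [one_smul] at h2
    exact h2
  have h2 := ((U t).restrictScalars ℝ).hasFDerivAt.comp_hasDerivAt t h1
  convert h2 using 1
  · funext s
    simp only [Function.comp_apply, ContinuousLinearMap.coe_restrictScalars']
    rw [← mul_apply_eq_comp, ← hU.map_add, add_sub_cancel]
  · simp

theorem IsUnitaryGroup.apply_mem_graph {A : H →ₗ.[ℂ] H} {U : ℝ → H →L[ℂ] H}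
    (hU : IsUnitaryGroup A U) {x y : H} (h : (x, y) ∈ A.graph) (t : ℝ) :
    (U t x, U t y) ∈ A.graph := by
  rw [hU.mem_graph_iff]
  have h0 := (hU.mem_graph_iff x y).mp h
  have h2 := ((U t).restrictScalars ℝ).hasFDerivAt.comp_hasDerivAt 0 h0
  convert h2 using 1
  · funext s
    simp only [Function.comp_apply, ContinuousLinearMap.coe_restrictScalars']
    rw [← mul_apply_eq_comp, ← mul_apply_eq_comp, ← hU.map_add,
      ← hU.map_add, add_comm]
  · simp

/-- The infinitesimal generator is symmetric: `⟨x, A x⟩` is real. -/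
theorem IsUnitaryGroup.re_inner_eq_zero {A : H →ₗ.[ℂ] H} {U : ℝ → H →L[ℂ] H}
    (hU : IsUnitaryGroup A U) {x y : H} (h : (x, y) ∈ A.graph) :
    (⟪x, Complex.I • y⟫_ℂ).re = 0 := by
  have h0 := hU.hasDerivAt h 0
  have h1 := h0.inner ℂ h0
  have h2 : (fun t => ⟪U t x, U t x⟫_ℂ) = fun _ => ((‖x‖ : ℂ)) ^ 2 := by
    funext t
    rw [inner_self_eq_norm_sq_to_K, hU.norm_map]; rfl
  rw [h2] at h1
  have h3 := h1.unique (hasDerivAt_const (0 : ℝ) _)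
  rw [hU.map_zero] at h3
  simp only [one_apply_eq_self] at h3
  have h4 := congrArg Complex.re h3
  have h5 : (⟪Complex.I • y, x⟫_ℂ).re = (⟪x, Complex.I • y⟫_ℂ).re := by
    rw [← inner_conj_symm]; exact Complex.conj_re _
  rw [Complex.add_re, h5, Complex.zero_re] at h4
  linarith

/-- A densely defined operator generates at most one unitary group. -/
theorem IsUnitaryGroup.unique {A : H →ₗ.[ℂ] H} {U V : ℝ → H →L[ℂ] H}
    (hA : Dense (A.domain : Set H)) (hU : IsUnitaryGroup A U) (hV : IsUnitaryGroup A V) : U = V := by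
  funext t
  refine ContinuousLinearMap.ext_on (s := (A.domain : Set H)) (by rwa [Submodule.span_eq]) fun x hx => ?_
  have h : (x, A ⟨x, hx⟩) ∈ A.graph := A.mem_graph ⟨x, hx⟩
  set y := A ⟨x, hx⟩
  have hd : ∀ s, HasDerivAt (fun s => (⟪U s x - V s x, U s x - V s x⟫_ℂ).re) 0 s := by
    intro s
    have h1 := (hU.hasDerivAt h s).sub (hV.hasDerivAt h s)
    have h2 : HasDerivAt (fun s => (⟪U s x - V s x, U s x - V s x⟫_ℂ).re) _ s :=
      Complex.reCLM.hasFDerivAt.comp_hasDerivAt s (h1.inner ℂ h1)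
    have hg : (U s x - V s x, U s y - V s y) ∈ A.graph :=
      A.graph.sub_mem (hU.apply_mem_graph h s) (hV.apply_mem_graph h s)
    have h3 := hU.re_inner_eq_zero hg
    convert h2 using 1
    rw [← smul_sub]
    simp only [Complex.reCLM_apply, Complex.add_re, Pi.sub_apply]
    have h4 : (⟪Complex.I • (U s y - V s y), U s x - V s x⟫_ℂ).re = 0 := by
      rw [← inner_conj_symm, Complex.conj_re, h3]
    rw [h3, h4, add_zero]
  have hc := is_const_of_deriv_eq_zero (fun s => (hd s).differentiableAt) (fun s => (hd s).deriv) t 0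
  simp only [hU.map_zero, hV.map_zero, sub_self, inner_zero_left, Complex.zero_re] at hc
  have h5 : ‖U t x - V t x‖ ^ 2 = 0 := by
    rw [← inner_self_eq_norm_sq (𝕜 := ℂ)]; exact hc
  exact sub_eq_zero.mp (norm_eq_zero.mp (pow_eq_zero_iff two_ne_zero |>.mp h5))

open Classical in
/-- The unitary group `t ↦ e^{itA}` of a self-adjoint operator `A` (and `0` if there is no such
group). -/
def unitaryGroup (A : H →ₗ.[ℂ] H) : ℝ → H →L[ℂ] H :=
  if h : ∃ U, IsUnitaryGroup A U then h.choose else 0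

/-- The Weyl operator `W_ε(u) = e^{i Φ_ε(u)}`. -/
def weyl {Z : Type*} [NormedAddCommGroup Z] [InnerProductSpace ℂ Z] (ε : ℝ) (u : Z) :
    FockSpace Z →L[ℂ] FockSpace Z :=
  unitaryGroup (segal ε u) 1

end Fock

end

/-! The argument is an energy estimate along the group `exp (i t Φ_ε(u))`, in a norm weighted by the
particle number.

The group is built first. On the finite particle space the field operator is symmetric, preserves
the space and raises the top particle number by at most one, so its `k`-th power costs about `c^k
√(k!)`. The exponential series therefore converges for every time on every vector. It is isometric
and extends to the whole space, and symmetry together with density of the range of the closed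
operator plus `i` shows that its generator is exactly the closure
(`HasEntireVectors.isUnitaryGroup`, `isUnitaryGroup_segal`).

For a bounded weight `w` acting by sectors as `V`, the derivative of `‖V U_t ψ‖²` is a commutator:
only the increments `w(n+1)² - w(n)²` survive, multiplied by a matrix element of size `√(n+1)`. If
these are at most `L w(n) w(n+1)`, Gronwall gives growth by at most `exp (L ‖u‖)`, whatever the
bound on `w` (`norm_weightMul_weyl_le`).

With `x = Re z`, the plain weight `(n+1)^x` would give an `L` growing with `x`. The shifted weight
`(n+1+x²)^x`, cut off at large `n`, satisfies the condition with `L = 2` for every `x`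
(`powWeight_step`). Returning to `(n+1)^x` costs `(1+x²)^x`, which is `exp (O(x log x))` for large
`x` and so is absorbed by `2^(x²)`, even after division by `‖u‖^x` (`exists_exp_mul_rpow_le`). The
imaginary part of `z` contributes only phases. -/

noncomputable section

namespace Fock

open Filter Topology

/-! ### Generation of unitary groups from entire vectors -/

section Generation

variable {H : Type*} [NormedAddCommGroup H] [InnerProductSpace ℂ H] {D : Submodule ℂ H}

/-- The graph of an endomorphism of a subspace, closed in the ambient space. -/
def closedGraph (S : D →ₗ[ℂ] D) : Submodule ℂ (H × H) :=
  (LinearMap.range (D.subtype.prod (D.subtype ∘ₗ S))).topologicalClosure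

theorem mk_mem_closedGraph (S : D →ₗ[ℂ] D) (x : D) : ((x : H), (S x : H)) ∈ closedGraph S :=
  Submodule.le_topologicalClosure _ ⟨x, rfl⟩

theorem isClosed_closedGraph (S : D →ₗ[ℂ] D) : IsClosed (closedGraph S : Set (H × H)) :=
  Submodule.isClosed_topologicalClosure _

theorem closedGraph_induction {S : D →ₗ[ℂ] D} {P : Set (H × H)} (hP : IsClosed P)
    (h : ∀ x : D, ((x : H), (S x : H)) ∈ P) {p : H × H} (hp : p ∈ closedGraph S) : p ∈ P := by
  refine closure_minimal ?_ hP hp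
  rintro _ ⟨x, rfl⟩
  exact h x

theorem closedGraph_seq {S : D →ₗ[ℂ] D} {p : H × H} (hp : p ∈ closedGraph S) :
    ∃ x : ℕ → D, Tendsto (fun k => (x k : H)) atTop (𝓝 p.1) ∧
      Tendsto (fun k => (S (x k) : H)) atTop (𝓝 p.2) := by
  obtain ⟨q, hq, hlim⟩ := mem_closure_iff_seq_limit.mp hp
  choose x hx using hq
  refine ⟨x, ?_, ?_⟩
  · have := (continuous_fst.tendsto p).comp hlim
    refine this.congr fun k => ?_
    simp [← hx]
  · have := (continuous_snd.tendsto p).comp hlim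
    refine this.congr fun k => ?_
    simp [← hx]

/-- If the derivative of a curve `h` is `i k` with `⟨h, k⟩` real, then the norm of `h` is constant. -/
theorem norm_eq_of_hasDerivAt_of_im_inner_eq_zero {h k : ℝ → H}
    (hd : ∀ t, HasDerivAt h (Complex.I • k t) t) (him : ∀ t, (⟪h t, k t⟫_ℂ).im = 0) (t : ℝ) :
    ‖h t‖ = ‖h 0‖ := by
  have hd2 : ∀ s, HasDerivAt (fun s => (⟪h s, h s⟫_ℂ).re) 0 s := by
    intro s
    have h2 : HasDerivAt (fun s => (⟪h s, h s⟫_ℂ).re) _ s :=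
      Complex.reCLM.hasFDerivAt.comp_hasDerivAt s ((hd s).inner ℂ (hd s))
    -- The derivative of `‖h‖²` is `2 Re ⟨h, i k⟩ = -2 Im ⟨h, k⟩`, which vanishes.
    convert h2 using 1
    have h3 : (⟪k s, h s⟫_ℂ).im = 0 := by rw [← inner_conj_symm, Complex.conj_im, him, neg_zero]
    simp [inner_smul_left, inner_smul_right, him, h3]
  have hc := is_const_of_deriv_eq_zero (fun s => (hd2 s).differentiableAt) (fun s => (hd2 s).deriv) t 0
  have h1 : ‖h t‖ ^ 2 = ‖h 0‖ ^ 2 := by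
    rw [← inner_self_eq_norm_sq (𝕜 := ℂ), ← inner_self_eq_norm_sq (𝕜 := ℂ)]; exact hc
  exact (sq_eq_sq₀ (norm_nonneg _) (norm_nonneg _)).mp h1

/-- All vectors of the domain are entire vectors. -/
def HasEntireVectors (S : D →ₗ[ℂ] D) : Prop :=
  ∀ (x : D) (r : ℝ), 0 ≤ r → Summable fun k : ℕ => r ^ k / k.factorial * ‖((S ^ k) x : H)‖

/-- The terms of the exponential series of `itS`. -/
def expTerm (S : D →ₗ[ℂ] D) (t : ℝ) (k : ℕ) : D →ₗ[ℂ] D :=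
  (((t : ℂ) * Complex.I) ^ k / (k.factorial : ℂ)) • S ^ k

theorem norm_expTerm (S : D →ₗ[ℂ] D) (t : ℝ) (k : ℕ) (x : D) :
    ‖(expTerm S t k x : H)‖ = |t| ^ k / k.factorial * ‖((S ^ k) x : H)‖ := by
  simp [expTerm, norm_smul]

theorem expTerm_comm (S : D →ₗ[ℂ] D) (t : ℝ) (k : ℕ) (x : D) :
    expTerm S t k (S x) = S (expTerm S t k x) := by
  simp only [expTerm, LinearMap.smul_apply, map_smul]
  rw [← Module.End.mul_apply, ← pow_succ, ← Module.End.mul_apply, ← pow_succ']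

/-- The index shift makes the termwise derivative of the series at `x` equal to `i` times the series
at `S x`; the term of index `0` is constant. -/
theorem hasDerivAt_expTerm_succ (S : D →ₗ[ℂ] D) (t : ℝ) (k : ℕ) (x : D) :
    HasDerivAt (fun t => (expTerm S t (k + 1) x : H)) (Complex.I • (expTerm S t k (S x) : H)) t := by
  have h1 : HasDerivAt (fun t : ℝ => (t : ℂ) * Complex.I) Complex.I t := by
    simpa using (Complex.ofRealCLM.hasDerivAt (x := t)).mul_const Complex.I
  have h2 := ((h1.fun_pow (k + 1)).div_const ((k + 1).factorial : ℂ)).smul_const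
    (((S ^ (k + 1)) x : D) : H)
  refine h2.congr_deriv ?_
  have h3 : (S ^ (k + 1)) x = (S ^ k) (S x) := by rw [pow_succ, Module.End.mul_apply]
  simp only [expTerm, LinearMap.smul_apply, Submodule.coe_smul, smul_smul, h3]
  congr 1
  have : (k.factorial : ℂ) ≠ 0 := by exact_mod_cast k.factorial_ne_zero
  have : (k : ℂ) + 1 ≠ 0 := by exact_mod_cast k.succ_ne_zero
  rw [Nat.factorial_succ]
  push_cast
  field_simp

/-! ### The exponential series on the domain. -/

variable [CompleteSpace H] {S : D →ₗ[ℂ] D}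

theorem HasEntireVectors.summable (hS : HasEntireVectors S) (t : ℝ) (x : D) :
    Summable fun k => (expTerm S t k x : H) := by
  refine Summable.of_norm_bounded (hS x |t| (abs_nonneg t)) fun k => ?_
  rw [norm_expTerm]

/-- The sum of the exponential series of `itS` on the domain. -/
def HasEntireVectors.expSum (hS : HasEntireVectors S) (t : ℝ) : D →ₗ[ℂ] H where
  toFun x := ∑' k, (expTerm S t k x : H)
  map_add' x y := by
    simp only [_root_.map_add, Submodule.coe_add]
    exact (hS.summable t x).tsum_add (hS.summable t y)
  map_smul' c x := by
    simp only [map_smul, Submodule.coe_smul, RingHom.id_apply]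
    exact (hS.summable t x).tsum_const_smul c

theorem HasEntireVectors.hasSum_expSum (hS : HasEntireVectors S) (t : ℝ) (x : D) :
    HasSum (fun k => (expTerm S t k x : H)) (hS.expSum t x) :=
  (hS.summable t x).hasSum

theorem HasEntireVectors.expSum_zero (hS : HasEntireVectors S) (x : D) : hS.expSum 0 x = x := by
  refine (hS.hasSum_expSum 0 x).unique ?_
  convert hasSum_single (f := fun k => (expTerm S 0 k x : H)) 0 fun k hk => ?_
  · simp [expTerm]
  · simp [expTerm, hk]

/-- Partial sums stay in `D` and commute with `S`, so they give points of the graph; closedness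
covers the limit. -/
theorem HasEntireVectors.expSum_mem_closedGraph (hS : HasEntireVectors S) (t : ℝ) (x : D) :
    (hS.expSum t x, hS.expSum t (S x)) ∈ closedGraph S := by
  refine (isClosed_closedGraph S).mem_of_tendsto
    ((hS.hasSum_expSum t x).tendsto_sum_nat.prodMk_nhds (hS.hasSum_expSum t (S x)).tendsto_sum_nat)
    (Eventually.of_forall fun m => ?_)
  have := mk_mem_closedGraph S (∑ k ∈ Finset.range m, expTerm S t k x)
  simpa [expTerm_comm] using this

theorem HasEntireVectors.hasDerivAt_expSum (hS : HasEntireVectors S) (t : ℝ) (x : D) :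
    HasDerivAt (fun t => hS.expSum t x) (Complex.I • hS.expSum t (S x)) t := by
  -- On this ball the derivatives are dominated by the entire-vector series of `S x` at radius `|t|
  -- + 1`, which justifies termwise differentiation.
  have ht : t ∈ Metric.ball (0 : ℝ) (|t| + 1) := by simp
  have hu : Summable fun k : ℕ => (|t| + 1) ^ k / k.factorial * ‖((S ^ k) (S x) : H)‖ :=
    hS (S x) (|t| + 1) (by positivity)
  have hsum : Summable fun k => (expTerm S t (k + 1) x : H) :=
    (summable_nat_add_iff (f := fun k => (expTerm S t k x : H)) 1).mpr (hS.summable t x)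
  have hb : ∀ (k : ℕ) (s : ℝ), s ∈ Metric.ball (0 : ℝ) (|t| + 1) →
      ‖Complex.I • (expTerm S s k (S x) : H)‖
        ≤ (|t| + 1) ^ k / k.factorial * ‖((S ^ k) (S x) : H)‖ := by
    intro k s hs
    rw [norm_smul, Complex.norm_I, one_mul, norm_expTerm]
    have : |s| ≤ |t| + 1 := by simpa using (mem_ball_zero_iff.mp hs).le
    gcongr
  have hpre : IsPreconnected (Metric.ball (0 : ℝ) (|t| + 1)) := (convex_ball _ _).isPreconnected
  have hg : ∀ (k : ℕ) (s : ℝ), s ∈ Metric.ball (0 : ℝ) (|t| + 1) →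
      HasDerivAt (fun s => (expTerm S s (k + 1) x : H)) (Complex.I • (expTerm S s k (S x) : H)) s :=
    fun k s _ => hasDerivAt_expTerm_succ S s k x
  have key : HasDerivAt (fun s => ∑' k, (expTerm S s (k + 1) x : H))
      (∑' k, Complex.I • (expTerm S t k (S x) : H)) t :=
    hasDerivAt_tsum_of_isPreconnected (g := fun k s => (expTerm S s (k + 1) x : H))
      (g' := fun k s => Complex.I • (expTerm S s k (S x) : H)) hu Metric.isOpen_ball
      hpre hg hb ht hsum ht
  have hI : ∑' k, Complex.I • (expTerm S t k (S x) : H) = Complex.I • hS.expSum t (S x) :=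
    (hS.summable t (S x)).tsum_const_smul _
  have hsplit : (fun t => hS.expSum t x) = fun t => (x : H) + ∑' k, (expTerm S t (k + 1) x : H) := by
    funext s
    refine (hS.summable s x).tsum_eq_zero_add.trans ?_
    simp [expTerm]
  rw [hsplit, ← hI]
  exact key.const_add _

/-- An endomorphism of a subspace which is symmetric for the ambient inner product. -/
def IsSymm (S : D →ₗ[ℂ] D) : Prop := ∀ x y : D, ⟪(S x : H), (y : H)⟫_ℂ = ⟪(x : H), (S y : H)⟫_ℂ

omit [CompleteSpace H] in
theorem IsSymm.im_inner_eq_zero (hsym : IsSymm S) {p : H × H} (hp : p ∈ closedGraph S) :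
    (⟪p.1, p.2⟫_ℂ).im = 0 := by
  refine closedGraph_induction (P := {p : H × H | (⟪p.1, p.2⟫_ℂ).im = 0})
    (isClosed_eq (by fun_prop) (by fun_prop)) (fun x => ?_) hp
  have h := hsym x x
  rw [← inner_conj_symm] at h
  exact Complex.conj_eq_iff_im.mp h

theorem HasEntireVectors.norm_expSum (hS : HasEntireVectors S) (hsym : IsSymm S) (t : ℝ) (x : D) :
    ‖hS.expSum t x‖ = ‖(x : H)‖ := by
  have h := norm_eq_of_hasDerivAt_of_im_inner_eq_zero (fun t => hS.hasDerivAt_expSum t x)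
    (fun t => hsym.im_inner_eq_zero (hS.expSum_mem_closedGraph t x)) t
  rwa [hS.expSum_zero] at h

/-- The continuous extension of the exponential series to the whole space. -/
def HasEntireVectors.group (hS : HasEntireVectors S) (t : ℝ) : H →L[ℂ] H :=
  (hS.expSum t).extendOfNorm D.subtype

/-! ### The extension to a unitary group and its generator. -/

variable (hS : HasEntireVectors S) (hsym : IsSymm S) (hD : Dense (D : Set H))

omit [CompleteSpace H] in
include hD in
theorem denseRange_subtype : DenseRange D.subtype := by
  simpa [DenseRange] using hD

include hsym hD

theorem HasEntireVectors.group_coe (t : ℝ) (x : D) : hS.group t x = hS.expSum t x :=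
  LinearMap.extendOfNorm_eq (denseRange_subtype hD)
    ⟨1, fun x => by rw [hS.norm_expSum hsym, one_mul]; rfl⟩ x

omit [CompleteSpace H] hsym in
theorem dense_induction {P : Set H} (hP : IsClosed P) (h : ∀ x : D, (x : H) ∈ P) (x : H) : x ∈ P :=
  hP.closure_subset_iff.mpr (fun y hy => h ⟨y, hy⟩) (hD x)

theorem HasEntireVectors.norm_group (t : ℝ) (x : H) : ‖hS.group t x‖ = ‖x‖ :=
  dense_induction hD (P := {x | ‖hS.group t x‖ = ‖x‖})
    (isClosed_eq (by fun_prop) (by fun_prop))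
    (fun x => by
      rw [Set.mem_ofPred_eq, hS.group_coe hsym hD, hS.norm_expSum hsym]) x

theorem HasEntireVectors.group_mem_closedGraph {p : H × H} (hp : p ∈ closedGraph S) (t : ℝ) :
    (hS.group t p.1, hS.group t p.2) ∈ closedGraph S := by
  refine closedGraph_induction
    (P := {p : H × H | (hS.group t p.1, hS.group t p.2) ∈ closedGraph S})
    ((isClosed_closedGraph S).preimage (by fun_prop)) (fun x => ?_) hp
  rw [Set.mem_ofPred_eq, hS.group_coe hsym hD, hS.group_coe hsym hD]
  exact hS.expSum_mem_closedGraph t x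

/-- Approximate `p` by graph points over `D`. Since every group element is isometric, the
derivatives converge uniformly in time, so the limit may be differentiated. -/
theorem HasEntireVectors.hasDerivAt_group {p : H × H} (hp : p ∈ closedGraph S) (t : ℝ) :
    HasDerivAt (fun t => hS.group t p.1) (Complex.I • hS.group t p.2) t := by
  obtain ⟨x, h1, h2⟩ := closedGraph_seq hp
  refine hasDerivAt_of_tendstoUniformly (l := atTop) (f := fun k t => hS.group t (x k))
    (f' := fun k t => Complex.I • hS.group t (S (x k))) (g' := fun t => Complex.I • hS.group t p.2)
    ?_ (Eventually.of_forall fun k s => ?_) (fun s => ?_) t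
  · rw [Metric.tendstoUniformly_iff]
    intro e he
    filter_upwards [Metric.tendsto_nhds.mp h2 e he] with k hk s
    rw [dist_eq_norm, ← smul_sub, ← map_sub, norm_smul, Complex.norm_I, one_mul,
      hS.norm_group hsym hD, ← dist_eq_norm, dist_comm]
    exact hk
  · simp only [hS.group_coe hsym hD]
    exact hS.hasDerivAt_expSum s (x k)
  · exact ((hS.group s).continuous.tendsto _).comp h1

theorem HasEntireVectors.continuous_group (x : H) : Continuous fun t => hS.group t x := by
  rw [continuous_iff_continuousAt]
  intro t
  refine Metric.continuousAt_iff'.mpr fun e he => ?_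
  obtain ⟨y, hy, hxy⟩ := Metric.dense_iff.mp hD x (e / 3) (by positivity)
  have hc : ContinuousAt (fun t => hS.group t y) t :=
    (hS.hasDerivAt_group hsym hD (mk_mem_closedGraph S ⟨_, hxy⟩) t).continuousAt
  filter_upwards [Metric.continuousAt_iff'.mp hc (e / 3) (by positivity)] with s hs
  have h1 : ∀ r, dist (hS.group r x) (hS.group r y) < e / 3 := fun r => by
    rw [dist_eq_norm, ← map_sub, hS.norm_group hsym hD, ← dist_eq_norm, dist_comm]
    exact hy
  have h2 := h1 s
  have h3 := h1 t
  rw [dist_comm] at h3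
  calc _ ≤ _ := dist_triangle4 _ (hS.group s y) (hS.group t y) _
    _ < e := by linarith

theorem HasEntireVectors.group_zero : hS.group 0 = 1 := by
  ext x
  refine dense_induction hD (P := {x | hS.group 0 x = x})
    (isClosed_eq (by fun_prop) (by fun_prop)) (fun x => ?_) x
  rw [Set.mem_ofPred_eq, hS.group_coe hsym hD, hS.expSum_zero]

/-- As functions of `s`, both sides solve the same equation with the same value at `s = 0`. Their
difference stays in the closed graph, where symmetry keeps its norm constant, hence zero. -/
theorem HasEntireVectors.group_add (s t : ℝ) : hS.group (s + t) = hS.group s * hS.group t := by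
  ext x
  refine dense_induction hD (P := {x | hS.group (s + t) x = hS.group s (hS.group t x)})
    (isClosed_eq (by fun_prop) (by fun_prop)) (fun x => ?_) x
  have hx := mk_mem_closedGraph S x
  have hx' := hS.group_mem_closedGraph hsym hD hx t
  have h := norm_eq_of_hasDerivAt_of_im_inner_eq_zero
    (h := fun s => hS.group s (hS.group t x) - hS.group (s + t) x)
    (k := fun s => hS.group s (hS.group t (S x)) - hS.group (s + t) (S x))
    (fun s => ?_) (fun s => ?_) s
  · simp only [hS.group_zero hsym hD, zero_add, one_apply_eq_self, sub_self, norm_zero,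
      norm_eq_zero] at h
    exact (sub_eq_zero.mp h).symm
  · rw [smul_sub]
    exact (hS.hasDerivAt_group hsym hD hx' s).sub
      ((hS.hasDerivAt_group hsym hD hx (s + t)).comp_add_const s t)
  · exact hsym.im_inner_eq_zero ((closedGraph S).sub_mem
      (hS.group_mem_closedGraph hsym hD hx' s) (hS.group_mem_closedGraph hsym hD hx (s + t)))

-- If `y` is orthogonal to this range, then `f t = ⟨y, U_t x⟩` satisfies `f' = f`. So `f` is a
-- multiple of `exp t`, yet it is bounded, and must vanish.
include hS in
theorem HasEntireVectors.dense_range_add_I :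
    Dense (Submodule.map (LinearMap.snd ℂ H H + Complex.I • LinearMap.fst ℂ H H)
      (closedGraph S) : Set H) := by
  rw [Submodule.dense_iff_topologicalClosure_eq_top, Submodule.topologicalClosure_eq_top_iff,
    Submodule.eq_bot_iff]
  intro y hy
  have hy' : ∀ p ∈ closedGraph S, ⟪y, p.2⟫_ℂ = -Complex.I * ⟪y, p.1⟫_ℂ := by
    intro p hp
    have := (Submodule.mem_orthogonal' _ _).mp hy _ (Submodule.mem_map_of_mem hp)
    simp only [LinearMap.add_apply, LinearMap.smul_apply, LinearMap.snd_apply, LinearMap.fst_apply,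
      inner_add_right, inner_smul_right] at this
    linear_combination this
  have key : ∀ x : D, ⟪y, (x : H)⟫_ℂ = 0 := by
    intro x
    set f : ℝ → ℂ := fun t => ⟪y, hS.group t x⟫_ℂ with hf
    have hd : ∀ t, HasDerivAt f (f t) t := by
      intro t
      have h1 := (hasDerivAt_const t y).inner ℂ
        (hS.hasDerivAt_group hsym hD (mk_mem_closedGraph S x) t)
      refine h1.congr_deriv ?_
      rw [inner_zero_left, add_zero, inner_smul_right,
        hy' _ (hS.group_mem_closedGraph hsym hD (mk_mem_closedGraph S x) t), ← mul_assoc]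
      simp [hf]
    have hexp : ∀ t, HasDerivAt (fun t : ℝ => (Real.exp (-t) : ℂ) * f t) 0 t := by
      intro t
      have h1 : HasDerivAt (fun t : ℝ => (Real.exp (-t) : ℂ)) ((Real.exp (-t) * -1 : ℝ) : ℂ) t :=
        (((hasDerivAt_id t).neg).exp).ofReal_comp
      refine (h1.mul (hd t)).congr_deriv ?_
      push_cast; ring
    have hc : ∀ t : ℝ, (Real.exp (-t) : ℂ) * f t = f 0 := fun t => by
      have := is_const_of_deriv_eq_zero (fun s => (hexp s).differentiableAt)
        (fun s => (hexp s).deriv) t 0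
      simpa using this
    have hb : ∀ t : ℝ, ‖f 0‖ ≤ Real.exp (-t) * (‖y‖ * ‖(x : H)‖) := fun t => by
      rw [← hc t, norm_mul, Complex.norm_real, Real.norm_of_nonneg (Real.exp_pos _).le]
      gcongr
      calc ‖f t‖ ≤ ‖y‖ * ‖hS.group t x‖ := norm_inner_le_norm _ _
        _ = _ := by rw [hS.norm_group hsym hD]
    have hl : Tendsto (fun t : ℝ => Real.exp (-t) * (‖y‖ * ‖(x : H)‖)) atTop (𝓝 0) := by
      simpa using (Real.tendsto_exp_neg_atTop_nhds_zero).mul_const (‖y‖ * ‖(x : H)‖)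
    have h0 : ‖f 0‖ ≤ 0 := ge_of_tendsto hl (Eventually.of_forall hb)
    have h00 := norm_le_zero_iff.mp h0
    simpa [hf, hS.group_zero hsym hD] using h00
  have := dense_induction hD (P := {x | ⟪y, x⟫_ℂ = 0}) (isClosed_eq (by fun_prop) (by fun_prop)) key y
  exact inner_self_eq_zero.mp this

/-- The generator is a symmetric extension of the closed operator, and density of the range leaves
no room for a proper one. Choose graph points `p k` with `(p k).2 + i (p k).1` tending to `y + i x`;
symmetry of the generator turns this into convergence of both components. -/
theorem HasEntireVectors.mem_closedGraph_of_hasDerivAt {x y : H}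
    (h : HasDerivAt (fun t => hS.group t x) (Complex.I • y) 0) : (x, y) ∈ closedGraph S := by
  have hre : ∀ {a b : H}, HasDerivAt (fun t => hS.group t a) (Complex.I • b) 0 →
      (⟪a, b⟫_ℂ).im = 0 := by
    intro a b hab
    have h1 : HasDerivAt (fun t => (⟪hS.group t a, hS.group t a⟫_ℂ).re) _ 0 :=
      Complex.reCLM.hasFDerivAt.comp_hasDerivAt 0 (hab.inner ℂ hab)
    have h2 : (fun t => (⟪hS.group t a, hS.group t a⟫_ℂ).re) = fun _ => ‖a‖ ^ 2 := by
      funext t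
      rw [← hS.norm_group hsym hD t a, ← inner_self_eq_norm_sq (𝕜 := ℂ)]
      rfl
    rw [h2] at h1
    have h3 := h1.unique (hasDerivAt_const (0 : ℝ) _)
    rw [hS.group_zero hsym hD] at h3
    have h4 : (⟪b, a⟫_ℂ).im = -(⟪a, b⟫_ℂ).im := by rw [← inner_conj_symm, Complex.conj_im]
    simp [inner_smul_left, inner_smul_right, h4] at h3
    linarith
  obtain ⟨q, hq, hlim⟩ := mem_closure_iff_seq_limit.mp
    (hS.dense_range_add_I hsym hD (y + Complex.I • x))
  choose p hp hpq using hq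
  -- The difference is again in the generator, so the cross term in `‖b + i a‖²` is the imaginary
  -- part of a real inner product.
  have hpyth : ∀ k, ‖y - (p k).2‖ ^ 2 + ‖x - (p k).1‖ ^ 2 = ‖(y + Complex.I • x) - q k‖ ^ 2 := by
    intro k
    have hg : HasDerivAt (fun t => hS.group t (p k).1) (Complex.I • (p k).2) 0 := by
      simpa [hS.group_zero hsym hD] using hS.hasDerivAt_group hsym hD (hp k) 0
    have h1 : (⟪x - (p k).1, y - (p k).2⟫_ℂ).im = 0 := by
      refine hre ?_
      have := h.sub hg
      rw [← smul_sub] at this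
      simpa [map_sub] using! this
    have h2 : (y + Complex.I • x) - q k = (y - (p k).2) + Complex.I • (x - (p k).1) := by
      rw [← hpq]
      simp only [LinearMap.add_apply, LinearMap.smul_apply, LinearMap.snd_apply,
        LinearMap.fst_apply, smul_sub]
      abel
    rw [h2, @norm_add_sq ℂ, norm_smul, Complex.norm_I, one_mul, inner_smul_right]
    have h4 : (⟪y - (p k).2, x - (p k).1⟫_ℂ).im = 0 := by
      rw [← inner_conj_symm, Complex.conj_im, h1, neg_zero]
    simp [h4]
  have hq0 : Tendsto (fun k => ‖(y + Complex.I • x) - q k‖ ^ 2) atTop (𝓝 0) := by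
    have := ((tendsto_const_nhds (x := y + Complex.I • x)).sub hlim).norm.pow 2
    simpa using this
  have aux : ∀ {a : H} {b : ℕ → H}, (∀ k, ‖a - b k‖ ^ 2 ≤ ‖(y + Complex.I • x) - q k‖ ^ 2) →
      Tendsto b atTop (𝓝 a) := by
    intro a b hab
    rw [tendsto_iff_norm_sub_tendsto_zero]
    have h1 : Tendsto (fun k => ‖(y + Complex.I • x) - q k‖) atTop (𝓝 0) := by
      simpa using ((tendsto_const_nhds (x := y + Complex.I • x)).sub hlim).norm
    refine squeeze_zero (fun _ => norm_nonneg _) (fun k => ?_) h1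
    rw [norm_sub_rev]
    exact (sq_le_sq₀ (norm_nonneg _) (norm_nonneg _)).mp (hab k)
  refine (isClosed_closedGraph S).mem_of_tendsto
    (Tendsto.prodMk_nhds (aux (a := x) (b := fun k => (p k).1) fun k => ?_)
      (aux (a := y) (b := fun k => (p k).2) fun k => ?_)) (Eventually.of_forall hp)
  · rw [← hpyth]; linarith [sq_nonneg ‖y - (p k).2‖]
  · rw [← hpyth]; linarith [sq_nonneg ‖x - (p k).1‖]

/-- A symmetric operator with a dense invariant domain of entire vectors has a closure that
generates a unitary group. -/
theorem HasEntireVectors.isUnitaryGroup {A : H →ₗ.[ℂ] H} (hA : A.graph = closedGraph S) :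
    IsUnitaryGroup A hS.group where
  map_zero := hS.group_zero hsym hD
  map_add := hS.group_add hsym hD
  norm_map := hS.norm_group hsym hD
  continuous := hS.continuous_group hsym hD
  mem_graph_iff x y := by
    rw [hA]
    refine ⟨fun h => ?_, hS.mem_closedGraph_of_hasDerivAt hsym hD⟩
    simpa [hS.group_zero hsym hD] using hS.hasDerivAt_group hsym hD h 0

end Generation

/-- Existence of one group makes the chosen one genuine; only its defining properties are used
afterwards. -/
theorem IsUnitaryGroup.unitaryGroup {H : Type*} [NormedAddCommGroup H] [InnerProductSpace ℂ H]
    {A : H →ₗ.[ℂ] H} {U : ℝ → H →L[ℂ] H} (hU : IsUnitaryGroup A U) :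
    IsUnitaryGroup A (unitaryGroup A) := by
  have h : ∃ U, IsUnitaryGroup A U := ⟨U, hU⟩
  rw [Fock.unitaryGroup, dif_pos h]
  exact h.choose_spec

/-! ### The symmetrization projection and the adjointness of creation and annihilation -/

section Symmetrization

variable {Z : Type*} [NormedAddCommGroup Z] [InnerProductSpace ℂ Z] {n : ℕ}

theorem perm_coe (σ : Equiv.Perm (Fin n)) (x : AlgTensor Z n) :
    perm σ (x : HilbTensor Z n) = ((permAlg σ x : AlgTensor Z n) : HilbTensor Z n) :=
  extendT_coe _ _ _ x

theorem inner_perm (σ : Equiv.Perm (Fin n)) (x y : HilbTensor Z n) :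
    ⟪perm σ x, perm σ y⟫_ℂ = ⟪x, y⟫_ℂ := by
  induction x, y using UniformSpace.Completion.induction_on₂ with
  | hp => exact isClosed_eq (by fun_prop) (by fun_prop)
  | ih x y =>
    rw [perm_coe, perm_coe, UniformSpace.Completion.inner_coe, UniformSpace.Completion.inner_coe,
      inner_permAlg]

/-- Permutations act by precomposition on the indices, hence from the right, which reverses the
order of the product. -/
theorem permAlg_permAlg (σ τ : Equiv.Perm (Fin n)) (x : AlgTensor Z n) :
    permAlg σ (permAlg τ x) = permAlg (τ * σ) x := by
  have h : (permAlg σ).comp (permAlg τ) = permAlg (Z := Z) (τ * σ) := hom_ext fun v => by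
    simp [Equiv.Perm.mul_apply]
  exact LinearMap.congr_fun h x

theorem perm_perm (σ τ : Equiv.Perm (Fin n)) (x : HilbTensor Z n) :
    perm σ (perm τ x) = perm (τ * σ) x := by
  induction x using UniformSpace.Completion.induction_on with
  | hp => exact isClosed_eq (by fun_prop) (by fun_prop)
  | ih x => rw [perm_coe, perm_coe, perm_coe, permAlg_permAlg]

theorem perm_one (x : HilbTensor Z n) : perm 1 x = x := by
  induction x using UniformSpace.Completion.induction_on with
  | hp => exact isClosed_eq (by fun_prop) (by fun_prop)
  | ih x =>
    rw [perm_coe]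
    congr 1
    exact LinearMap.congr_fun (hom_ext (f := permAlg 1) (g := LinearMap.id) fun v => by simp) x

theorem symmetrize_apply (x : HilbTensor Z n) :
    symmetrize Z n x = (n.factorial : ℂ)⁻¹ • ∑ σ : Equiv.Perm (Fin n), perm σ x := by
  simp [symmetrize]

/-- Each permutation is unitary with adjoint its inverse, and averaging over the group is invariant
under inversion. -/
theorem inner_symmetrize (x y : HilbTensor Z n) :
    ⟪symmetrize Z n x, y⟫_ℂ = ⟪x, symmetrize Z n y⟫_ℂ := by
  have h : ∀ σ : Equiv.Perm (Fin n), ⟪perm σ x, y⟫_ℂ = ⟪x, perm σ⁻¹ y⟫_ℂ := fun σ => by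
    rw [← inner_perm σ x, perm_perm, inv_mul_cancel, perm_one]
  rw [symmetrize_apply, symmetrize_apply, inner_smul_left, inner_smul_right, sum_inner, inner_sum]
  simp only [h, map_inv₀, map_natCast]
  congr 1
  exact Equiv.sum_comp (Equiv.inv (Equiv.Perm (Fin n))) fun σ => ⟪x, perm σ y⟫_ℂ

theorem perm_symmetrize (σ : Equiv.Perm (Fin n)) (x : HilbTensor Z n) :
    perm σ (symmetrize Z n x) = symmetrize Z n x := by
  rw [symmetrize_apply, map_smul, map_sum]
  simp only [perm_perm]
  congr 1
  exact Equiv.sum_comp (Equiv.mulRight σ) fun τ => perm τ x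

theorem symmetrize_symmetrize (x : HilbTensor Z n) :
    symmetrize Z n (symmetrize Z n x) = symmetrize Z n x := by
  rw [symmetrize_apply (symmetrize Z n x)]
  simp only [perm_symmetrize, Finset.sum_const, Finset.card_univ, Fintype.card_perm,
    Fintype.card_fin]
  rw [← Nat.cast_smul_eq_nsmul ℂ, smul_smul, inv_mul_cancel₀, one_smul]
  exact_mod_cast n.factorial_ne_zero

theorem norm_symmetrize_le (x : HilbTensor Z n) : ‖symmetrize Z n x‖ ≤ ‖x‖ := by
  have h : ‖symmetrize Z n x‖ ^ 2 ≤ ‖x‖ * ‖symmetrize Z n x‖ := by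
    rw [← inner_self_eq_norm_sq (𝕜 := ℂ), inner_symmetrize, symmetrize_symmetrize]
    exact re_inner_le_norm _ _
  rcases (norm_nonneg (symmetrize Z n x)).eq_or_lt with h0 | h0
  · rw [← h0]; exact norm_nonneg x
  · rw [pow_two] at h
    exact le_of_mul_le_mul_right h h0

theorem symmetrize_sector (x : Sector Z n) :
    symmetrize Z n (x : HilbTensor Z n) = (x : HilbTensor Z n) := by
  obtain ⟨_, y, rfl⟩ := x
  exact symmetrize_symmetrize y

instance : CompleteSpace (Sector Z n) := by
  have h : (Sector Z n : Set (HilbTensor Z n)) = {x | symmetrize Z n x = x} := by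
    ext x
    exact ⟨fun hx => symmetrize_sector ⟨x, hx⟩, fun hx => ⟨x, hx⟩⟩
  have hc : IsClosed (Sector Z n : Set (HilbTensor Z n)) := by
    rw [h]; exact isClosed_eq (by fun_prop) (by fun_prop)
  exact hc.completeSpace_coe

instance : Inner ℂ (Sector Z n) := InnerProductSpace.toInner

/-- On vectors already in a sector the symmetrizations can be moved across and dropped; what remains
is the adjointness of `bra` and `ket`. -/
theorem inner_createSector (ε : ℝ) (u : Z) (n : ℕ) (x : Sector Z n) (y : Sector Z (n + 1)) :
    ⟪createSector ε u n x, y⟫_ℂ = ⟪x, annihilateSector ε u n y⟫_ℂ := by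
  have h : ⟪symmOnto Z (n + 1) (ket n u x), y⟫_ℂ = ⟪x, symmOnto Z n (bra n u y)⟫_ℂ := by
    change ⟪symmetrize Z (n + 1) (ket n u x), (y : HilbTensor Z (n + 1))⟫_ℂ
      = ⟪(x : HilbTensor Z n), symmetrize Z n (bra n u y)⟫_ℂ
    rw [inner_symmetrize, symmetrize_sector, ← inner_symmetrize, symmetrize_sector, bra,
      ContinuousLinearMap.adjoint_inner_right]
  have h1 := inner_smul_left (symmOnto Z (n + 1) (ket n u x)) y ((√(ε * (n + 1)) : ℝ) : ℂ)
  have h2 := inner_smul_right x (symmOnto Z n (bra n u y)) ((√(ε * (n + 1)) : ℝ) : ℂ)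
  rw [Complex.conj_ofReal, h] at h1
  exact h1.trans h2.symm

theorem norm_ket_apply_le (u : Z) (x : HilbTensor Z n) : ‖ket n u x‖ ≤ ‖u‖ * ‖x‖ := by
  induction x using UniformSpace.Completion.induction_on with
  | hp => exact isClosed_le (by fun_prop) (by fun_prop)
  | ih x =>
    rw [ket, extendT_coe, UniformSpace.Completion.norm_coe, UniformSpace.Completion.norm_coe,
      norm_ketAlg]

theorem norm_createSector_le (ε : ℝ) (u : Z) (n : ℕ) (x : Sector Z n) :
    ‖createSector ε u n x‖ ≤ √(ε * (n + 1)) * ‖u‖ * ‖x‖ := by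
  rw [createSector, smul_apply, norm_smul, Complex.norm_real,
    Real.norm_of_nonneg (Real.sqrt_nonneg _), mul_assoc]
  refine mul_le_mul_of_nonneg_left ?_ (Real.sqrt_nonneg _)
  exact (norm_symmetrize_le (ket n u x)).trans (norm_ket_apply_le u _)

/-- Duality: with `a` the annihilated vector, `‖a‖²` is the inner product of the created vector of
`a` with `y`, so the creation bound applies. -/
theorem norm_annihilateSector_le (ε : ℝ) (u : Z) (n : ℕ) (y : Sector Z (n + 1)) :
    ‖annihilateSector ε u n y‖ ≤ √(ε * (n + 1)) * ‖u‖ * ‖y‖ := by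
  set a := annihilateSector ε u n y
  have h : ‖a‖ ^ 2 ≤ √(ε * (n + 1)) * ‖u‖ * ‖a‖ * ‖y‖ := by
    rw [← inner_self_eq_norm_sq (𝕜 := ℂ), ← inner_createSector]
    exact (re_inner_le_norm _ _).trans
      (mul_le_mul_of_nonneg_right (norm_createSector_le ε u n a) (norm_nonneg y))
  rcases (norm_nonneg a).eq_or_lt with h0 | h0
  · rw [← h0]; positivity
  · refine le_of_mul_le_mul_right (a := ‖a‖) ?_ h0
    linarith [h, pow_two ‖a‖]

end Symmetrization

/-! ### The Segal field operator generates a unitary group -/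

section Segal

variable {Z : Type*} [NormedAddCommGroup Z] [InnerProductSpace ℂ Z]

theorem hasSum_norm_sq (ψ : FockSpace Z) : HasSum (fun n => ‖ψ n‖ ^ 2) (‖ψ‖ ^ 2) := by
  simpa using lp.hasSum_norm (p := 2) (by norm_num) ψ

theorem exists_forall_lt_eq_zero (ψ : finiteParticle Z) :
    ∃ N : ℕ, ∀ n, N < n → (ψ : FockSpace Z) n = 0 := by
  obtain ⟨N, hN⟩ := ψ.2.bddAbove
  refine ⟨N, fun n hn => ?_⟩
  by_contra h
  exact absurd (hN h) (not_le.mpr hn)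

theorem sum_single_mem_finiteParticle (s : Finset ℕ) (f : ∀ n, Sector Z n) :
    ∑ n ∈ s, (lp.single 2 n (f n) : FockSpace Z) ∈ finiteParticle Z := by
  refine Submodule.sum_mem _ fun n _ => (Set.finite_singleton n).subset fun m hm => ?_
  by_contra h
  exact hm (lp.single_apply_ne (E := fun n => Sector Z n) 2 n (f n) h)

theorem dense_finiteParticle : Dense (finiteParticle Z : Set (FockSpace Z)) := fun ψ =>
  mem_closure_of_tendsto (lp.hasSum_single (by norm_num) ψ)
    (Eventually.of_forall fun s => sum_single_mem_finiteParticle s ψ)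

/-- The Segal field operator as an endomorphism of the finite particle space. -/
def segalEnd (ε : ℝ) (u : Z) : finiteParticle Z →ₗ[ℂ] finiteParticle Z :=
  LinearMap.codRestrict (finiteParticle Z) (((((√2)⁻¹ : ℝ) : ℂ)) • (create ε u + annihilate ε u))
    fun ψ => (finiteParticle Z).smul_mem _ ((finiteParticle Z).add_mem
      (createComp_finite ε u ψ) (annihilateComp_finite ε u ψ))

theorem segalEnd_coe (ε : ℝ) (u : Z) (ψ : finiteParticle Z) :
    (segalEnd ε u ψ : FockSpace Z) = ((((√2)⁻¹ : ℝ) : ℂ)) • (create ε u ψ + annihilate ε u ψ) :=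
  rfl

theorem create_apply_zero (ε : ℝ) (u : Z) (ψ : finiteParticle Z) : create ε u ψ 0 = 0 := rfl

theorem create_apply_succ (ε : ℝ) (u : Z) (ψ : finiteParticle Z) (n : ℕ) :
    create ε u ψ (n + 1) = createSector ε u n ((ψ : FockSpace Z) n) := rfl

theorem annihilate_apply (ε : ℝ) (u : Z) (ψ : finiteParticle Z) (n : ℕ) :
    annihilate ε u ψ n = annihilateSector ε u n ((ψ : FockSpace Z) (n + 1)) := rfl

theorem inner_create (ε : ℝ) (u : Z) (φ ψ : finiteParticle Z) :
    ⟪create ε u φ, (ψ : FockSpace Z)⟫_ℂ = ⟪(φ : FockSpace Z), annihilate ε u ψ⟫_ℂ := by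
  have hs := lp.summable_inner (𝕜 := ℂ) (create ε u φ) (ψ : FockSpace Z)
  rw [lp.inner_eq_tsum, lp.inner_eq_tsum, hs.tsum_eq_zero_add,
    create_apply_zero, inner_zero_left, zero_add]
  simp only [create_apply_succ, annihilate_apply, inner_createSector]

theorem inner_annihilate (ε : ℝ) (u : Z) (φ ψ : finiteParticle Z) :
    ⟪annihilate ε u φ, (ψ : FockSpace Z)⟫_ℂ = ⟪(φ : FockSpace Z), create ε u ψ⟫_ℂ := by
  rw [← inner_conj_symm, ← inner_create, inner_conj_symm]

theorem isSymm_segalEnd (ε : ℝ) (u : Z) : IsSymm (segalEnd ε u) := fun φ ψ => by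
  have h : ⟪create ε u φ + annihilate ε u φ, (ψ : FockSpace Z)⟫_ℂ
      = ⟪(φ : FockSpace Z), create ε u ψ + annihilate ε u ψ⟫_ℂ := by
    rw [inner_add_left, inner_add_right, inner_create, inner_annihilate, add_comm]
  rw [segalEnd_coe, segalEnd_coe, inner_smul_left, inner_smul_right, h, Complex.conj_ofReal]

theorem segalEnd_apply_eq_zero (ε : ℝ) (u : Z) {ψ : finiteParticle Z} {N : ℕ}
    (hψ : ∀ n, N < n → (ψ : FockSpace Z) n = 0) (n : ℕ) (hn : N + 1 < n) :
    (segalEnd ε u ψ : FockSpace Z) n = 0 := by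
  obtain ⟨n, rfl⟩ : ∃ m, n = m + 1 := ⟨n - 1, by omega⟩
  have h : (segalEnd ε u ψ : FockSpace Z) (n + 1)
      = ((((√2)⁻¹ : ℝ) : ℂ)) • (create ε u ψ (n + 1) + annihilate ε u ψ (n + 1)) := rfl
  rw [h, create_apply_succ, annihilate_apply, hψ n (by omega), hψ (n + 1 + 1) (by omega)]
  simp

theorem norm_create_le {ε : ℝ} (hε : 0 ≤ ε) (u : Z) {ψ : finiteParticle Z} {N : ℕ}
    (hψ : ∀ n, N < n → (ψ : FockSpace Z) n = 0) :
    ‖create ε u ψ‖ ≤ √(ε * (N + 1)) * ‖u‖ * ‖(ψ : FockSpace Z)‖ := by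
  refine (sq_le_sq₀ (norm_nonneg _) (by positivity)).mp ?_
  rw [mul_pow]
  have h := ((hasSum_nat_add_iff' 1).mpr (hasSum_norm_sq (create ε u ψ)))
  simp only [Finset.range_one, Finset.sum_singleton, create_apply_zero, norm_zero, ne_eq,
    OfNat.ofNat_ne_zero, not_false_eq_true, zero_pow, sub_zero, create_apply_succ] at h
  refine hasSum_le (fun n => ?_) h ((hasSum_norm_sq (ψ : FockSpace Z)).mul_left _)
  rcases le_or_gt n N with hn | hn
  · calc _ ≤ (√(ε * (n + 1)) * ‖u‖ * ‖(ψ : FockSpace Z) n‖) ^ 2 := by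
          gcongr; exact norm_createSector_le ε u n _
      _ ≤ _ := by
          rw [mul_pow]
          gcongr
  · simp [hψ n hn]

theorem norm_annihilate_le {ε : ℝ} (hε : 0 ≤ ε) (u : Z) {ψ : finiteParticle Z} {N : ℕ}
    (hψ : ∀ n, N < n → (ψ : FockSpace Z) n = 0) :
    ‖annihilate ε u ψ‖ ≤ √(ε * (N + 1)) * ‖u‖ * ‖(ψ : FockSpace Z)‖ := by
  refine (sq_le_sq₀ (norm_nonneg _) (by positivity)).mp ?_
  rw [mul_pow]
  have h := (hasSum_nat_add_iff' 1).mpr (hasSum_norm_sq (ψ : FockSpace Z))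
  refine (hasSum_le (fun n => ?_) (hasSum_norm_sq (annihilate ε u ψ)) (h.mul_left _)).trans
    (mul_le_mul_of_nonneg_left (by simp) (by positivity))
  rw [annihilate_apply]
  rcases le_or_gt n N with hn | hn
  · calc _ ≤ (√(ε * (n + 1)) * ‖u‖ * ‖(ψ : FockSpace Z) (n + 1)‖) ^ 2 := by
          gcongr; exact norm_annihilateSector_le ε u n _
      _ ≤ _ := by
          rw [mul_pow]
          gcongr
  · simp [hψ (n + 1) (by omega)]

theorem norm_segalEnd_le {ε : ℝ} (hε : 0 ≤ ε) (u : Z) {ψ : finiteParticle Z} {N : ℕ}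
    (hψ : ∀ n, N < n → (ψ : FockSpace Z) n = 0) :
    ‖(segalEnd ε u ψ : FockSpace Z)‖ ≤ 2 * (√(ε * (N + 1)) * ‖u‖) * ‖(ψ : FockSpace Z)‖ := by
  have h2 : (√2)⁻¹ ≤ 1 := inv_le_one_of_one_le₀ (by rw [Real.one_le_sqrt]; norm_num)
  rw [segalEnd_coe, norm_smul, Complex.norm_real, Real.norm_of_nonneg (by positivity)]
  calc _ ≤ 1 * ‖create ε u ψ + annihilate ε u ψ‖ := by gcongr
    _ ≤ ‖create ε u ψ‖ + ‖annihilate ε u ψ‖ := by rw [one_mul]; exact norm_add_le _ _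
    _ ≤ _ := by linarith [norm_create_le hε u hψ, norm_annihilate_le hε u hψ]

theorem segalEnd_pow_apply_eq_zero (ε : ℝ) (u : Z) {ψ : finiteParticle Z} {N : ℕ}
    (hψ : ∀ n, N < n → (ψ : FockSpace Z) n = 0) (k : ℕ) :
    ∀ n, N + k < n → ((segalEnd ε u ^ k) ψ : FockSpace Z) n = 0 := by
  induction k with
  | zero => simpa using hψ
  | succ k ih =>
    rw [pow_succ', Module.End.mul_apply]
    exact segalEnd_apply_eq_zero ε u ih

/-- The `k`-th power of the field lives on at most `N + k` particles, so one more application costs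
`O(√(k+1))` while the factorial gains `k + 1`. The ratio test applies. -/
theorem hasEntireVectors_segalEnd {ε : ℝ} (hε : 0 ≤ ε) (u : Z) :
    HasEntireVectors (segalEnd ε u) := by
  intro ψ r hr
  obtain ⟨N, hN⟩ := exists_forall_lt_eq_zero ψ
  refine summable_of_ratio_norm_eventually_le (r := 1 / 2) (by norm_num) ?_
  set c : ℝ := r * (2 * (√ε * √(N + 1) * ‖u‖)) with hc
  have hc0 : 0 ≤ c := by positivity
  have hlim : Tendsto (fun k : ℕ => √((k : ℝ) + 1)) atTop atTop :=
    Real.tendsto_sqrt_atTop.comp (tendsto_atTop_add_const_right _ _ tendsto_natCast_atTop_atTop)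
  -- Once `√(k+1) ≥ 2 c`, the cost `c √(k+1)` is at most half of `k + 1`, giving ratio `1/2`.
  filter_upwards [hlim.eventually_ge_atTop (2 * c)] with k hk
  have h1 := norm_segalEnd_le hε u (segalEnd_pow_apply_eq_zero ε u hN k)
  rw [← Module.End.mul_apply, ← pow_succ'] at h1
  have hsq : √(ε * ((N + k : ℕ) + 1)) ≤ √ε * √(N + 1) * √(k + 1) := by
    rw [← Real.sqrt_mul hε, ← Real.sqrt_mul (by positivity)]
    refine Real.sqrt_le_sqrt ?_
    rw [mul_assoc]
    refine mul_le_mul_of_nonneg_left ?_ hε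
    push_cast
    have : (0 : ℝ) ≤ (N : ℝ) * k := by positivity
    linarith
  set b : ℝ := ‖((segalEnd ε u ^ k) ψ : FockSpace Z)‖ with hb
  have hk1 : (√((k : ℝ) + 1)) ^ 2 = k + 1 := Real.sq_sqrt (by positivity)
  have hb0 : 0 ≤ b := norm_nonneg _
  rw [Real.norm_of_nonneg (by positivity), Real.norm_of_nonneg (by positivity)]
  have h2 : r * ‖((segalEnd ε u ^ (k + 1)) ψ : FockSpace Z)‖ ≤ 1 / 2 * (k + 1) * b := by
    calc _ ≤ r * (2 * (√(ε * ((N + k : ℕ) + 1)) * ‖u‖) * b) := by gcongr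
      _ ≤ r * (2 * (√ε * √(N + 1) * √(k + 1) * ‖u‖) * b) := by gcongr
      _ = 1 / 2 * (√((k : ℝ) + 1) * (2 * c)) * b := by rw [hc]; ring
      _ ≤ 1 / 2 * (√((k : ℝ) + 1) * √((k : ℝ) + 1)) * b := by gcongr
      _ = _ := by rw [← pow_two, hk1]
  have hf : (0 : ℝ) < k.factorial := by exact_mod_cast k.factorial_pos
  calc r ^ (k + 1) / (k + 1).factorial * ‖((segalEnd ε u ^ (k + 1)) ψ : FockSpace Z)‖
      = r ^ k / ((k + 1) * k.factorial) * (r * ‖((segalEnd ε u ^ (k + 1)) ψ : FockSpace Z)‖) := by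
        rw [Nat.factorial_succ]; push_cast; ring
    _ ≤ r ^ k / ((k + 1) * k.factorial) * (1 / 2 * (k + 1) * b) := by gcongr
    _ = _ := by field_simp

/-- An operator with dense domain that has a formal adjoint with dense domain is closable. -/
theorem isClosable_of_isFormalAdjoint {H : Type*} [NormedAddCommGroup H] [InnerProductSpace ℂ H]
    [CompleteSpace H] {A B : H →ₗ.[ℂ] H} (hB : Dense (B.domain : Set H))
    (h : B.IsFormalAdjoint A) : A.IsClosable :=
  (LinearPMap.adjoint_isClosed hB).isClosable.leIsClosable (h.le_adjoint hB)

theorem isFormalAdjoint_segalFin (ε : ℝ) (u : Z) :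
    (segalFin ε u).IsFormalAdjoint (segalFin ε u) := by
  intro φ ψ
  exact isSymm_segalEnd ε u φ ψ

/-- Symmetry on a dense domain gives closability, so the closure is the genuine one and not a
default value. -/
theorem segal_graph (ε : ℝ) (u : Z) : (segal ε u).graph = closedGraph (segalEnd ε u) := by
  have hcl : (segalFin ε u).IsClosable :=
    isClosable_of_isFormalAdjoint (B := segalFin ε u) dense_finiteParticle
      (isFormalAdjoint_segalFin ε u)
  rw [segal, ← hcl.graph_closure_eq_closure_graph, closedGraph]
  congr 1
  ext p
  rw [LinearPMap.mem_graph_iff]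
  exact ⟨fun ⟨x, h1, h2⟩ => ⟨x, Prod.ext h1 h2⟩, fun ⟨x, h⟩ =>
    ⟨x, congrArg Prod.fst h, congrArg Prod.snd h⟩⟩

theorem isUnitaryGroup_segal {ε : ℝ} (hε : 0 ≤ ε) (u : Z) :
    IsUnitaryGroup (segal ε u) (unitaryGroup (segal ε u)) :=
  ((hasEntireVectors_segalEnd hε u).isUnitaryGroup (isSymm_segalEnd ε u) dense_finiteParticle
    (segal_graph ε u)).unitaryGroup

end Segal

/-! ### The graph of a complex power of the number operator -/

section NumberPow

variable {Z : Type*} [NormedAddCommGroup Z] [InnerProductSpace ℂ Z]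

theorem conj_natCast_add_one_cpow (n : ℕ) (z : ℂ) :
    conj (((n : ℂ) + 1) ^ z) = ((n : ℂ) + 1) ^ conj z := by
  have h : ((n : ℂ) + 1).arg ≠ Real.pi := by
    have : ((n : ℂ) + 1) = ((n + 1 : ℝ) : ℂ) := by push_cast; rfl
    rw [this, Complex.arg_ofReal_of_nonneg (by positivity)]
    exact Real.pi_pos.ne
  rw [Complex.cpow_conj _ _ h]
  simp

/-- Multiplication by the conjugate power is a densely defined formal adjoint. -/
theorem isClosable_numberPowFin (z : ℂ) : (numberPowFin Z z).IsClosable := by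
  refine isClosable_of_isFormalAdjoint (B := numberPowFin Z (conj z)) dense_finiteParticle
    fun φ ψ => ?_
  refine (lp.inner_eq_tsum _ _).trans (Eq.trans (tsum_congr fun n => ?_) (lp.inner_eq_tsum _ _).symm)
  have h1 := inner_smul_left (φ.1 n) (ψ.1 n) (((n : ℂ) + 1) ^ conj z)
  have h2 := inner_smul_right (φ.1 n) (ψ.1 n) (((n : ℂ) + 1) ^ z)
  rw [conj_natCast_add_one_cpow, Complex.conj_conj] at h1
  exact h1.trans h2.symm

theorem mem_numberPowFin_graph_iff {z : ℂ} {p : FockSpace Z × FockSpace Z} :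
    p ∈ (numberPowFin Z z).graph ↔
      p.1 ∈ finiteParticle Z ∧ ∀ n : ℕ, p.2 n = ((n : ℂ) + 1) ^ z • p.1 n := by
  rw [LinearPMap.mem_graph_iff]
  constructor
  · rintro ⟨x, h1, h2⟩
    refine ⟨h1 ▸ x.2, fun n => ?_⟩
    rw [← h1, ← h2]
    rfl
  · rintro ⟨h1, h2⟩
    exact ⟨⟨p.1, h1⟩, rfl, lp.ext (funext fun n => (h2 n).symm)⟩

theorem continuous_apply_sector (n : ℕ) : Continuous fun φ : FockSpace Z => φ n :=
  (lp.evalCLM ℂ (fun n => Sector Z n) 2 n).continuous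

/-- The closure has the maximal domain. The sectorwise relation is closed; conversely, truncating to
finitely many sectors approximates both components at once. Domain questions thereby become square
summability. -/
theorem mem_numberPow_graph_iff {z : ℂ} {ψ η : FockSpace Z} :
    (ψ, η) ∈ (numberPow Z z).graph ↔ ∀ n : ℕ, η n = ((n : ℂ) + 1) ^ z • ψ n := by
  rw [numberPow, ← (isClosable_numberPowFin z).graph_closure_eq_closure_graph]
  constructor
  · intro h
    have hcl : IsClosed {p : FockSpace Z × FockSpace Z |
        ∀ n : ℕ, p.2 n = ((n : ℂ) + 1) ^ z • p.1 n} := by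
      simp only [Set.ofPred_forall]
      refine isClosed_iInter fun n => ?_
      have h1 : Continuous fun p : FockSpace Z × FockSpace Z => p.1 n :=
        (continuous_apply_sector n).comp continuous_fst
      have h2 : Continuous fun p : FockSpace Z × FockSpace Z => p.2 n :=
        (continuous_apply_sector n).comp continuous_snd
      exact isClosed_eq h2 (h1.const_smul (((n : ℂ) + 1) ^ z))
    exact closure_minimal (fun p hp => (mem_numberPowFin_graph_iff.mp hp).2) hcl h
  · intro h
    refine mem_closure_of_tendsto (Tendsto.prodMk_nhds (lp.hasSum_single (by norm_num) ψ)
      (lp.hasSum_single (by norm_num) η)) (Eventually.of_forall fun s => ?_)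
    refine mem_numberPowFin_graph_iff.mpr ⟨sum_single_mem_finiteParticle s ψ, fun n => ?_⟩
    simp only [lp.coeFn_sum, Finset.sum_apply, Finset.smul_sum]
    refine Finset.sum_congr rfl fun m _ => ?_
    rcases eq_or_ne n m with rfl | hnm
    · rw [lp.single_apply_self, lp.single_apply_self, h]
    · rw [lp.single_apply_ne _ _ _ hnm, lp.single_apply_ne _ _ _ hnm, smul_zero]

end NumberPow

/-! ### Weighted norms along the unitary group -/

section Weights

variable {Z : Type*} [NormedAddCommGroup Z] [InnerProductSpace ℂ Z]

theorem memℓp_two_of_summable {f : ∀ n, Sector Z n} (h : Summable fun n => ‖f n‖ ^ 2) :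
    Memℓp f 2 :=
  memℓp_gen (by simpa using h)

theorem norm_sq_smul_le {f : ℕ → ℂ} {C : ℝ} (hf : ∀ n, ‖f n‖ ≤ C) (ψ : FockSpace Z) (n : ℕ) :
    ‖f n • ψ n‖ ^ 2 ≤ C ^ 2 * ‖ψ n‖ ^ 2 := by
  rw [norm_smul, mul_pow]
  have := hf n
  gcongr

theorem memℓp_smul {f : ℕ → ℂ} {C : ℝ} (hf : ∀ n, ‖f n‖ ≤ C) (ψ : FockSpace Z) :
    Memℓp (fun n => f n • ψ n) 2 :=
  memℓp_two_of_summable (((hasSum_norm_sq ψ).summable.mul_left (C ^ 2)).of_nonneg_of_le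
    (fun _ => by positivity) (norm_sq_smul_le hf ψ))

/-- Multiplication of the `n`-particle sector by a bounded sequence of numbers, as a linear map. -/
def sectorMulLin (f : ℕ → ℂ) (C : ℝ) (hf : ∀ n, ‖f n‖ ≤ C) : FockSpace Z →ₗ[ℂ] FockSpace Z where
  toFun ψ := ⟨fun n => f n • ψ n, memℓp_smul hf ψ⟩
  map_add' φ ψ := lp.ext (funext fun n => smul_add (f n) (φ n) (ψ n))
  map_smul' c ψ := lp.ext (funext fun n => smul_comm (f n) c (ψ n))

theorem sectorMulLin_apply {f : ℕ → ℂ} {C : ℝ} (hf : ∀ n, ‖f n‖ ≤ C) (ψ : FockSpace Z) (n : ℕ) :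
    sectorMulLin f C hf ψ n = f n • ψ n := rfl

theorem norm_sectorMulLin_le {f : ℕ → ℂ} {C : ℝ} (hf : ∀ n, ‖f n‖ ≤ C) (ψ : FockSpace Z) :
    ‖sectorMulLin f C hf ψ‖ ≤ C * ‖ψ‖ := by
  have hC : 0 ≤ C := (norm_nonneg _).trans (hf 0)
  refine (sq_le_sq₀ (norm_nonneg _) (by positivity)).mp ?_
  rw [mul_pow]
  refine hasSum_le (fun n => ?_) (hasSum_norm_sq (sectorMulLin f C hf ψ))
    ((hasSum_norm_sq ψ).mul_left _)
  rw [sectorMulLin_apply]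
  exact norm_sq_smul_le hf ψ n

/-- Multiplication of the `n`-particle sector by a bounded sequence of numbers. -/
def sectorMul (f : ℕ → ℂ) (C : ℝ) (hf : ∀ n, ‖f n‖ ≤ C) : FockSpace Z →L[ℂ] FockSpace Z :=
  (sectorMulLin f C hf).mkContinuous C (norm_sectorMulLin_le hf)

/-- Multiplication of the `n`-particle sector by a bounded sequence of real weights. -/
def weightMul (w : ℕ → ℝ) (C : ℝ) (hw : ∀ n, |w n| ≤ C) : FockSpace Z →L[ℂ] FockSpace Z :=
  sectorMul (fun n => (w n : ℂ)) C fun n => by simpa using hw n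

theorem weightMul_apply {w : ℕ → ℝ} {C : ℝ} (hw : ∀ n, |w n| ≤ C) (ψ : FockSpace Z) (n : ℕ) :
    weightMul w C hw ψ n = (w n : ℂ) • ψ n := rfl

theorem hasSum_inner_weightMul {w : ℕ → ℝ} {C : ℝ} (hw : ∀ n, |w n| ≤ C) (φ ψ : FockSpace Z) :
    HasSum (fun n => ((w n ^ 2 : ℝ) : ℂ) * ⟪φ n, ψ n⟫_ℂ) ⟪weightMul w C hw φ, weightMul w C hw ψ⟫_ℂ := by
  have h : ∀ n, ((w n ^ 2 : ℝ) : ℂ) * ⟪φ n, ψ n⟫_ℂ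
      = ⟪weightMul w C hw φ n, weightMul w C hw ψ n⟫_ℂ := by
    intro n
    have h1 := inner_smul_left (φ n) ((w n : ℂ) • ψ n) (w n : ℂ)
    have h2 := inner_smul_right (φ n) (ψ n) (w n : ℂ)
    rw [h2, Complex.conj_ofReal] at h1
    rw [weightMul_apply, weightMul_apply]
    refine Eq.trans ?_ h1.symm
    push_cast
    ring
  simp only [h]
  exact lp.hasSum_inner (𝕜 := ℂ) (weightMul w C hw φ) (weightMul w C hw ψ)

theorem hasSum_norm_sq_weightMul {w : ℕ → ℝ} {C : ℝ} (hw : ∀ n, |w n| ≤ C) (ψ : FockSpace Z) :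
    HasSum (fun n => w n ^ 2 * ‖ψ n‖ ^ 2) (‖weightMul w C hw ψ‖ ^ 2) := by
  have h : ∀ n, w n ^ 2 * ‖ψ n‖ ^ 2 = ‖weightMul w C hw ψ n‖ ^ 2 := by
    intro n
    rw [weightMul_apply, norm_smul, mul_pow, Complex.norm_real, Real.norm_eq_abs, sq_abs]
  simp only [h]
  exact hasSum_norm_sq (weightMul w C hw ψ)

/-! ### The commutator estimate and Gronwall's inequality. -/

theorem im_inner_annihilateSector (ε : ℝ) (u : Z) (n : ℕ) (x : Sector Z n) (y : Sector Z (n + 1)) :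
    (⟪x, annihilateSector ε u n y⟫_ℂ).im = -(⟪y, createSector ε u n x⟫_ℂ).im := by
  rw [← inner_createSector, ← inner_conj_symm, Complex.conj_im]

/-- Here `√ε` is replaced by `1`, which makes all later bounds uniform in `ε`. -/
theorem abs_im_inner_createSector_le {ε : ℝ} (hε1 : ε ≤ 1) (u : Z) (n : ℕ)
    (x : Sector Z n) (y : Sector Z (n + 1)) :
    |(⟪y, createSector ε u n x⟫_ℂ).im| ≤ √((n : ℝ) + 1) * (‖u‖ * (‖x‖ * ‖y‖)) := by
  refine (Complex.abs_im_le_norm _).trans ((norm_inner_le_norm _ _).trans ?_)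
  calc _ ≤ ‖y‖ * (√(ε * (n + 1)) * ‖u‖ * ‖x‖) :=
        mul_le_mul_of_nonneg_left (norm_createSector_le ε u n x) (norm_nonneg _)
    _ ≤ ‖y‖ * (√(1 * (n + 1)) * ‖u‖ * ‖x‖) := by gcongr
    _ = _ := by rw [one_mul]; ring

/-- Between sectors `n` and `n + 1`, creation carries the weight `w(n+1)²` and annihilation `w(n)²`.
Being adjoint, they have opposite imaginary parts, so only the difference of the weights remains. -/
theorem im_inner_weightMul_segalEnd {w : ℕ → ℝ} {C : ℝ} (hw : ∀ n, |w n| ≤ C) {ε : ℝ}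
    (u : Z) (ψ : finiteParticle Z) :
    HasSum (fun n => (√2)⁻¹ * ((w (n + 1) ^ 2 - w n ^ 2) *
        (inner ℂ (E := Sector Z (n + 1)) ((ψ : FockSpace Z) (n + 1))
          (createSector ε u n ((ψ : FockSpace Z) n))).im))
      (⟪weightMul w C hw (ψ : FockSpace Z), weightMul w C hw (segalEnd ε u ψ : FockSpace Z)⟫_ℂ).im := by
  have h1 := (hasSum_nat_add_iff' 1).mpr
    (hasSum_inner_weightMul hw (ψ : FockSpace Z) (create ε u ψ))
  have h2 := hasSum_inner_weightMul hw (ψ : FockSpace Z) (annihilate ε u ψ)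
  rw [Finset.sum_range_one, create_apply_zero, inner_zero_right, mul_zero, sub_zero] at h1
  have h3 := Complex.hasSum_im ((h1.add h2).mul_left (((√2)⁻¹ : ℝ) : ℂ))
  rw [segalEnd_coe, map_smul, _root_.map_add, inner_smul_right, inner_add_right]
  convert h3 using 1
  funext n
  have h4 : (⟪(ψ : FockSpace Z) n, annihilate ε u ψ n⟫_ℂ).im
      = -(inner ℂ (E := Sector Z (n + 1)) ((ψ : FockSpace Z) (n + 1))
          (createSector ε u n ((ψ : FockSpace Z) n))).im := by
    rw [annihilate_apply]
    exact im_inner_annihilateSector ε u n ((ψ : FockSpace Z) n) ((ψ : FockSpace Z) (n + 1))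
  rw [create_apply_succ, Complex.im_ofReal_mul, Complex.add_im, Complex.im_ofReal_mul,
    Complex.im_ofReal_mul, h4]
  ring

theorem abs_im_inner_weightMul_segalEnd_le {w : ℕ → ℝ} {C : ℝ} (hw : ∀ n, |w n| ≤ C)
    {L : ℝ} (hL : 0 ≤ L)
    (hd : ∀ n : ℕ, |w (n + 1) ^ 2 - w n ^ 2| * √((n : ℝ) + 1) ≤ L * (w n * w (n + 1)))
    {ε : ℝ} (hε1 : ε ≤ 1) (u : Z) (ψ : finiteParticle Z) :
    |(⟪weightMul w C hw (ψ : FockSpace Z), weightMul w C hw (segalEnd ε u ψ : FockSpace Z)⟫_ℂ).im|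
      ≤ L * ‖u‖ * ‖weightMul w C hw (ψ : FockSpace Z)‖ ^ 2 := by
  have h := hasSum_norm_sq_weightMul hw (ψ : FockSpace Z)
  -- Splitting the product of neighbouring components by the arithmetic-geometric mean counts each
  -- sector twice, except the vacuum, which is missing from the shifted sum.
  have h' := (hasSum_nat_add_iff' 1).mpr h
  have hs := (h.add h').mul_left (L * ‖u‖ / 2)
  refine ((im_inner_weightMul_segalEnd hw u ψ).norm_le_of_bounded hs fun n => ?_).trans ?_
  · set a := ‖(ψ : FockSpace Z) n‖
    set b := ‖(ψ : FockSpace Z) (n + 1)‖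
    have h2 : (√2)⁻¹ ≤ 1 := inv_le_one_of_one_le₀ (by rw [Real.one_le_sqrt]; norm_num)
    have hg : |(inner ℂ (E := Sector Z (n + 1)) ((ψ : FockSpace Z) (n + 1))
          (createSector ε u n ((ψ : FockSpace Z) n))).im|
        ≤ √((n : ℝ) + 1) * (‖u‖ * (a * b)) :=
      abs_im_inner_createSector_le hε1 u n ((ψ : FockSpace Z) n) ((ψ : FockSpace Z) (n + 1))
    rw [Real.norm_eq_abs, abs_mul, abs_mul, abs_of_nonneg (a := (√2)⁻¹) (by positivity)]
    calc _ ≤ 1 * (|w (n + 1) ^ 2 - w n ^ 2| * (√((n : ℝ) + 1) * (‖u‖ * (a * b)))) := by gcongr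
      _ = (|w (n + 1) ^ 2 - w n ^ 2| * √((n : ℝ) + 1)) * (‖u‖ * (a * b)) := by ring
      _ ≤ L * (w n * w (n + 1)) * (‖u‖ * (a * b)) :=
          mul_le_mul_of_nonneg_right (hd n) (by positivity)
      _ = L * ‖u‖ / 2 * (2 * (w n * a) * (w (n + 1) * b)) := by ring
      _ ≤ L * ‖u‖ / 2 * ((w n * a) ^ 2 + (w (n + 1) * b) ^ 2) := by
          gcongr; exact two_mul_le_add_sq _ _
      _ = _ := by ring
  · have h0 : 0 ≤ w 0 ^ 2 * ‖(ψ : FockSpace Z) 0‖ ^ 2 := by positivity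
    have h1 : 0 ≤ L * ‖u‖ / 2 := by positivity
    rw [Finset.sum_range_one]
    nlinarith [mul_nonneg h1 h0]

/-- The orbit of a finite particle vector need not stay in the finite particle space. As `V` is
bounded, both sides are continuous and the estimate extends to the closure. -/
theorem abs_im_inner_map_le_of_mem_closedGraph {H : Type*} [NormedAddCommGroup H]
    [InnerProductSpace ℂ H] {D : Submodule ℂ H} {S : D →ₗ[ℂ] D} (V : H →L[ℂ] H) {c : ℝ}
    (h : ∀ x : D, |(⟪V x, V (S x)⟫_ℂ).im| ≤ c * ‖V x‖ ^ 2) {p : H × H} (hp : p ∈ closedGraph S) :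
    |(⟪V p.1, V p.2⟫_ℂ).im| ≤ c * ‖V p.1‖ ^ 2 :=
  closedGraph_induction (P := {p : H × H | |(⟪V p.1, V p.2⟫_ℂ).im| ≤ c * ‖V p.1‖ ^ 2})
    (isClosed_le (by fun_prop) (by fun_prop)) h hp

theorem abs_im_inner_weightMul_le_of_mem_graph {w : ℕ → ℝ} {C : ℝ} (hw : ∀ n, |w n| ≤ C)
    {L : ℝ} (hL : 0 ≤ L)
    (hd : ∀ n : ℕ, |w (n + 1) ^ 2 - w n ^ 2| * √((n : ℝ) + 1) ≤ L * (w n * w (n + 1)))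
    {ε : ℝ} (hε1 : ε ≤ 1) (u : Z) {p : FockSpace Z × FockSpace Z}
    (hp : p ∈ (segal ε u).graph) :
    |(⟪weightMul w C hw p.1, weightMul w C hw p.2⟫_ℂ).im|
      ≤ L * ‖u‖ * ‖weightMul w C hw p.1‖ ^ 2 := by
  rw [segal_graph] at hp
  exact abs_im_inner_map_le_of_mem_closedGraph (weightMul w C hw)
    (fun ψ => abs_im_inner_weightMul_segalEnd_le hw hL hd hε1 u ψ) hp

/-- A curve whose logarithmic derivative is at most `c` grows at most like `exp (c t)`. -/
theorem le_exp_mul_of_hasDerivAt_le {f f' : ℝ → ℝ} {c : ℝ} (hf : ∀ t, HasDerivAt f (f' t) t)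
    (hle : ∀ t, f' t ≤ c * f t) {t : ℝ} (ht : 0 ≤ t) : f t ≤ Real.exp (c * t) * f 0 := by
  have hd : ∀ s, HasDerivAt (fun s => Real.exp (-(c * s)) * f s)
      (Real.exp (-(c * s)) * (f' s - c * f s)) s := by
    intro s
    have h1 : HasDerivAt (fun s => -(c * s)) (-(c * 1)) s := ((hasDerivAt_id s).const_mul c).neg
    refine (h1.exp.mul (hf s)).congr_deriv ?_
    ring
  have hanti : Antitone fun s => Real.exp (-(c * s)) * f s :=
    antitone_of_deriv_nonpos (fun s => (hd s).differentiableAt) fun s => by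
      rw [(hd s).deriv]
      exact mul_nonpos_of_nonneg_of_nonpos (Real.exp_pos _).le (by linarith [hle s])
  have h := hanti ht
  simp only [mul_zero, neg_zero, Real.exp_zero, one_mul] at h
  calc f t = Real.exp (c * t) * (Real.exp (-(c * t)) * f t) := by
        rw [← mul_assoc, ← Real.exp_add]; simp
    _ ≤ _ := by gcongr

/-- Gronwall for `‖V U_t ψ‖²`. The constant depends on `L` and not on `C`, so unbounded weights can
be reached through truncations. -/
theorem norm_weightMul_weyl_le {w : ℕ → ℝ} {C : ℝ} (hw : ∀ n, |w n| ≤ C)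
    {L : ℝ} (hL : 0 ≤ L)
    (hd : ∀ n : ℕ, |w (n + 1) ^ 2 - w n ^ 2| * √((n : ℝ) + 1) ≤ L * (w n * w (n + 1)))
    {ε : ℝ} (hε : 0 ≤ ε) (hε1 : ε ≤ 1) (u : Z) (ψ : FockSpace Z) :
    ‖weightMul w C hw (weyl ε u ψ)‖ ≤ Real.exp (L * ‖u‖) * ‖weightMul w C hw ψ‖ := by
  have hU := isUnitaryGroup_segal hε u
  set U := unitaryGroup (segal ε u)
  set V : FockSpace Z →L[ℂ] FockSpace Z := weightMul w C hw
  refine dense_induction dense_finiteParticle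
    (P := {ψ | ‖V (U 1 ψ)‖ ≤ Real.exp (L * ‖u‖) * ‖V ψ‖})
    (isClosed_le (by fun_prop) (by fun_prop)) (fun ψ => ?_) ψ
  have hg : ((ψ : FockSpace Z), (segalEnd ε u ψ : FockSpace Z)) ∈ (segal ε u).graph := by
    rw [segal_graph]; exact mk_mem_closedGraph _ ψ
  have hder : ∀ t, HasDerivAt (fun t => ‖V (U t ψ)‖ ^ 2)
      (-2 * (⟪V (U t ψ), V (U t (segalEnd ε u ψ))⟫_ℂ).im) t := by
    intro t
    have h1 : HasDerivAt (fun t => V (U t ψ)) (V (Complex.I • U t (segalEnd ε u ψ))) t :=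
      (V.restrictScalars ℝ).hasFDerivAt.comp_hasDerivAt t (hU.hasDerivAt hg t)
    rw [map_smul] at h1
    have h2 : HasDerivAt (fun t => (⟪V (U t ψ), V (U t ψ)⟫_ℂ).re) _ t :=
      Complex.reCLM.hasFDerivAt.comp_hasDerivAt t (h1.inner ℂ h1)
    have h3 : (fun t => (⟪V (U t ψ), V (U t ψ)⟫_ℂ).re) = fun t => ‖V (U t ψ)‖ ^ 2 := by
      funext t
      exact inner_self_eq_norm_sq (𝕜 := ℂ) _
    rw [h3] at h2
    refine h2.congr_deriv ?_
    have h4 : (⟪V (U t (segalEnd ε u ψ)), V (U t ψ)⟫_ℂ).im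
        = -(⟪V (U t ψ), V (U t (segalEnd ε u ψ))⟫_ℂ).im := by
      rw [← inner_conj_symm, Complex.conj_im]
    rw [inner_smul_left, inner_smul_right]
    simp [h4]
    ring
  have hle : ∀ t, -2 * (⟪V (U t ψ), V (U t (segalEnd ε u ψ))⟫_ℂ).im
      ≤ (2 * (L * ‖u‖)) * ‖V (U t ψ)‖ ^ 2 := by
    intro t
    have h1 := abs_im_inner_weightMul_le_of_mem_graph hw hL hd hε1 u
      (hU.apply_mem_graph hg t)
    have h2 := neg_le_of_abs_le h1
    linarith
  have h := le_exp_mul_of_hasDerivAt_le hder hle zero_le_one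
  rw [hU.map_zero] at h
  refine (sq_le_sq₀ (norm_nonneg _) (by positivity)).mp (h.trans_eq ?_)
  rw [mul_pow, ← Real.exp_nat_mul]
  simp

/-- The weight `(n + 1 + x²)^x`, constant from `n = m` on. -/
def powWeight (x : ℝ) (m n : ℕ) : ℝ := (((min n m : ℕ) : ℝ) + 1 + x ^ 2) ^ x

theorem powWeight_pos (x : ℝ) (m n : ℕ) : 0 < powWeight x m n := by
  unfold powWeight; positivity

theorem abs_powWeight_le {x : ℝ} (hx : 0 ≤ x) (m n : ℕ) :
    |powWeight x m n| ≤ ((m : ℝ) + 1 + x ^ 2) ^ x := by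
  rw [abs_of_pos (powWeight_pos x m n)]
  unfold powWeight
  gcongr
  exact min_le_right _ _

/-- Below the cutoff, `log w` increases by at most `x / (n+1+x²)` in one step, and the shift by `x²`
bounds this by `1 / (2 √(n+1))` uniformly in `x`. Beyond the cutoff the weight is constant. -/
theorem powWeight_step {x : ℝ} (hx : 0 ≤ x) (m n : ℕ) :
    |powWeight x m (n + 1) ^ 2 - powWeight x m n ^ 2| * √((n : ℝ) + 1)
      ≤ 2 * (powWeight x m n * powWeight x m (n + 1)) := by
  have hp := powWeight_pos x m n
  have hp' := powWeight_pos x m (n + 1)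
  rcases le_or_gt m n with hmn | hmn
  · have h : powWeight x m (n + 1) = powWeight x m n := by
      unfold powWeight; rw [min_eq_right hmn, min_eq_right (by omega)]
    rw [h, sub_self, abs_zero, zero_mul]
    positivity
  · set w := powWeight x m n with hw
    set w' := powWeight x m (n + 1) with hw'
    set s := √((n : ℝ) + 1) with hs
    have hs1 : 1 ≤ s := by rw [hs, Real.one_le_sqrt]; linarith [n.cast_nonneg (α := ℝ)]
    have hs2 : s ^ 2 = n + 1 := Real.sq_sqrt (by positivity)
    set y : ℝ := (n : ℝ) + 1 + x ^ 2 with hy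
    have hy0 : 0 < y := by positivity
    have e1 : w = y ^ x := by rw [hw, powWeight, min_eq_left hmn.le]
    have e2 : w' = (y * (1 + 1 / y)) ^ x := by
      rw [hw', powWeight, min_eq_left (by omega)]
      congr 1
      rw [mul_add, mul_one_div_cancel hy0.ne', hy]
      push_cast; ring
    -- This is `2 s x ≤ s² + x²`, with `s² = n + 1`.
    have hδ : x / y ≤ 1 / (2 * s) := by
      rw [div_le_div_iff₀ hy0 (by positivity), hy, ← hs2]
      nlinarith [sq_nonneg (s - x)]
    have hδ1 : 1 / (2 * s) ≤ 1 := by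
      rw [div_le_one (by positivity)]; linarith
    have hexp : (1 + 1 / y) ^ x ≤ 1 + 1 / s := by
      calc (1 + 1 / y) ^ x ≤ Real.exp (1 / y) ^ x := by
            gcongr
            linarith [Real.add_one_le_exp (1 / y)]
        _ = Real.exp (x / y) := by rw [← Real.exp_mul]; congr 1; ring
        _ ≤ Real.exp (1 / (2 * s)) := by gcongr
        -- For `0 ≤ δ ≤ 1` one has `exp δ ≤ 1 + 2 δ`.
        _ ≤ 1 + 2 * (1 / (2 * s)) := by
            have h := Real.abs_exp_sub_one_le (x := 1 / (2 * s))
              (by rw [abs_of_pos (by positivity)]; exact hδ1)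
            rw [abs_of_pos (a := 1 / (2 * s)) (by positivity)] at h
            linarith [le_of_abs_le h]
        _ = _ := by field_simp
    have hle : w' ≤ w * (1 + 1 / s) := by
      rw [e2, Real.mul_rpow hy0.le (by positivity), ← e1]
      gcongr
    have hge : w ≤ w' := by
      rw [hw, hw', powWeight, powWeight]
      gcongr
      omega
    have hdiff : (w' - w) * s ≤ w := by
      have h1 : w' - w ≤ w * (1 / s) := by linarith
      calc (w' - w) * s ≤ w * (1 / s) * s := by gcongr
        _ = w := by field_simp
    rw [abs_of_nonneg (by nlinarith)]
    calc (w' ^ 2 - w ^ 2) * s = ((w' - w) * s) * (w' + w) := by ring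
      _ ≤ w * (w' + w') := by gcongr
      _ = _ := by ring

/-! ### Complex powers of the number operator and the Weyl operator. -/

theorem norm_natCast_add_one_cpow (n : ℕ) (z : ℂ) :
    ‖((n : ℂ) + 1) ^ z‖ = ((n : ℝ) + 1) ^ z.re := by
  have h : ((n : ℂ) + 1) = ((n + 1 : ℝ) : ℂ) := by push_cast; rfl
  rw [h, Complex.norm_cpow_eq_rpow_re_of_pos (by positivity)]

/-- The Weyl operator does not increase the weighted norm given by `(N₁ + 1)^z` by more than
`exp (2 ‖u‖) (1 + (Re z)²)^{Re z}`. -/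
theorem sum_norm_sq_cpow_smul_weyl_le {z : ℂ} (hz : 0 ≤ z.re) {ε : ℝ} (hε : 0 ≤ ε) (hε1 : ε ≤ 1)
    (u : Z) {ψ η : FockSpace Z} (h : (ψ, η) ∈ (numberPow Z z).graph) (s : Finset ℕ) :
    ∑ n ∈ s, ‖((n : ℂ) + 1) ^ z • weyl ε u ψ n‖ ^ 2
      ≤ (Real.exp (2 * ‖u‖) * ((1 + z.re ^ 2) ^ z.re * ‖η‖)) ^ 2 := by
  rw [mem_numberPow_graph_iff] at h
  -- Cutting the weight off at an upper bound `m` of `s` leaves it intact on `s`; the final bound is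
  -- free of `m`.
  obtain ⟨m, hm⟩ := s.bddAbove
  set x := z.re
  have hw := abs_powWeight_le hz m
  set V : FockSpace Z →L[ℂ] FockSpace Z := weightMul (powWeight x m) _ hw
  have h1 : ‖V (weyl ε u ψ)‖ ≤ Real.exp (2 * ‖u‖) * ‖V ψ‖ :=
    norm_weightMul_weyl_le hw zero_le_two
      (powWeight_step hz m) hε hε1 u ψ
  -- The price of the shift comes from `n + 1 + x² ≤ (1 + x²)(n + 1)`.
  have h2 : ‖V ψ‖ ≤ (1 + x ^ 2) ^ x * ‖η‖ := by
    refine (sq_le_sq₀ (norm_nonneg _) (by positivity)).mp ?_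
    rw [mul_pow]
    refine hasSum_le (fun n => ?_) (hasSum_norm_sq_weightMul hw ψ)
      ((hasSum_norm_sq η).mul_left _)
    rw [← mul_pow, ← mul_pow, h n, norm_smul, norm_natCast_add_one_cpow, ← mul_assoc,
      ← Real.mul_rpow (by positivity) (by positivity)]
    have h3 : powWeight x m n ≤ ((1 + x ^ 2) * ((n : ℝ) + 1)) ^ x := by
      unfold powWeight
      gcongr
      have h4 : ((min n m : ℕ) : ℝ) ≤ n := by exact_mod_cast min_le_left n m
      nlinarith [sq_nonneg x, n.cast_nonneg (α := ℝ), mul_nonneg (sq_nonneg x) (n.cast_nonneg (α := ℝ))]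
    have := (powWeight_pos x m n).le
    gcongr
  have h3 : ∑ n ∈ s, ‖((n : ℂ) + 1) ^ z • weyl ε u ψ n‖ ^ 2 ≤ ‖V (weyl ε u ψ)‖ ^ 2 := by
    have hs := hasSum_norm_sq_weightMul hw (weyl ε u ψ)
    refine le_trans (Finset.sum_le_sum fun n hn => ?_) (sum_le_hasSum s (fun n _ => by positivity) hs)
    have hnm : n ≤ m := hm hn
    rw [norm_smul, norm_natCast_add_one_cpow, mul_pow, powWeight, min_eq_left hnm]
    have : ((n : ℝ) + 1) ^ x ≤ ((n : ℝ) + 1 + x ^ 2) ^ x :=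
      Real.rpow_le_rpow (by positivity) (by linarith [sq_nonneg x]) hz
    gcongr
  refine h3.trans ?_
  have : ‖V (weyl ε u ψ)‖ ≤ Real.exp (2 * ‖u‖) * ((1 + x ^ 2) ^ x * ‖η‖) := h1.trans (by gcongr)
  gcongr

theorem memℓp_cpow_smul_weyl {z : ℂ} (hz : 0 ≤ z.re) {ε : ℝ} (hε : 0 ≤ ε) (hε1 : ε ≤ 1)
    (u : Z) {ψ η : FockSpace Z} (h : (ψ, η) ∈ (numberPow Z z).graph) :
    Memℓp (fun n : ℕ => ((n : ℂ) + 1) ^ z • weyl ε u ψ n) 2 :=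
  memℓp_two_of_summable (summable_of_sum_le (fun _ => by positivity)
    (sum_norm_sq_cpow_smul_weyl_le hz hε hε1 u h))

theorem weyl_mem_domain_numberPow {z : ℂ} (hz : 0 ≤ z.re) {ε : ℝ} (hε : 0 ≤ ε) (hε1 : ε ≤ 1)
    (u : Z) {ψ : FockSpace Z} (h : ψ ∈ (numberPow Z z).domain) :
    weyl ε u ψ ∈ (numberPow Z z).domain := by
  have h1 := memℓp_cpow_smul_weyl hz hε hε1 u ((numberPow Z z).mem_graph ⟨ψ, h⟩)
  have h2 : (weyl ε u ψ, (⟨_, h1⟩ : FockSpace Z)) ∈ (numberPow Z z).graph :=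
    mem_numberPow_graph_iff.mpr fun n => rfl
  exact LinearPMap.mem_domain_of_mem_graph h2

theorem norm_natCast_add_one_cpow_neg_le {z : ℂ} (hz : 0 ≤ z.re) (n : ℕ) :
    ‖((n : ℂ) + 1) ^ (-z)‖ ≤ 1 := by
  rw [norm_natCast_add_one_cpow]
  exact Real.rpow_le_one_of_one_le_of_nonpos (by linarith [n.cast_nonneg (α := ℝ)]) (by simpa)

/-- The bounded operator `(N₁ + 1)^{-z}` for `Re z ≥ 0`. -/
def numberPowNeg {z : ℂ} (hz : 0 ≤ z.re) : FockSpace Z →L[ℂ] FockSpace Z :=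
  sectorMul (fun n => ((n : ℂ) + 1) ^ (-z)) 1 (norm_natCast_add_one_cpow_neg_le hz)

theorem mk_numberPowNeg_mem_graph {z : ℂ} (hz : 0 ≤ z.re) (χ : FockSpace Z) :
    (χ, numberPowNeg hz χ) ∈ (numberPow Z (-z)).graph :=
  mem_numberPow_graph_iff.mpr fun _ => rfl

theorem numberPowNeg_mk_mem_graph {z : ℂ} (hz : 0 ≤ z.re) (χ : FockSpace Z) :
    (numberPowNeg hz χ, χ) ∈ (numberPow Z z).graph := by
  refine mem_numberPow_graph_iff.mpr fun n => ?_
  have h : (n : ℂ) + 1 ≠ 0 := by exact_mod_cast n.succ_ne_zero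
  have h1 : numberPowNeg hz χ n = ((n : ℂ) + 1) ^ (-z) • χ n := rfl
  rw [h1, smul_smul, ← Complex.cpow_add _ _ h, add_neg_cancel, Complex.cpow_zero, one_smul]

/-- The operator `(N₁ + 1)^z W_ε(u) (N₁ + 1)^{-z}`. -/
def conjWeyl {z : ℂ} (hz : 0 ≤ z.re) {ε : ℝ} (hε : 0 ≤ ε) (hε1 : ε ≤ 1) (u : Z) :
    FockSpace Z →L[ℂ] FockSpace Z :=
  LinearMap.mkContinuous
    { toFun := fun χ => ⟨fun n => ((n : ℂ) + 1) ^ z • weyl ε u (numberPowNeg hz χ) n,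
        memℓp_cpow_smul_weyl hz hε hε1 u (numberPowNeg_mk_mem_graph hz χ)⟩
      map_add' := fun φ χ => by
        refine lp.ext (funext fun n => ?_)
        simp only [_root_.map_add]
        exact smul_add _ _ _
      map_smul' := fun c χ => by
        refine lp.ext (funext fun n => ?_)
        simp only [map_smul]
        exact smul_comm _ c _ }
    (Real.exp (2 * ‖u‖) * (1 + z.re ^ 2) ^ z.re)
    fun χ => by
      refine lp.norm_le_of_forall_sum_le (by norm_num) (by positivity) fun s => ?_
      have h := sum_norm_sq_cpow_smul_weyl_le hz hε hε1 u (numberPowNeg_mk_mem_graph hz χ) s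
      rw [← mul_assoc] at h
      simpa using h

theorem norm_conjWeyl_le {z : ℂ} (hz : 0 ≤ z.re) {ε : ℝ} (hε : 0 ≤ ε) (hε1 : ε ≤ 1) (u : Z) :
    ‖conjWeyl hz hε hε1 u‖ ≤ Real.exp (2 * ‖u‖) * (1 + z.re ^ 2) ^ z.re :=
  LinearMap.mkContinuous_norm_le _ (by positivity) _

theorem mk_conjWeyl_mem_graph {z : ℂ} (hz : 0 ≤ z.re) {ε : ℝ} (hε : 0 ≤ ε) (hε1 : ε ≤ 1) (u : Z)
    (χ : FockSpace Z) :
    (weyl ε u (numberPowNeg hz χ), conjWeyl hz hε hε1 u χ) ∈ (numberPow Z z).graph :=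
  mem_numberPow_graph_iff.mpr fun _ => rfl

end Weights

/-- After taking logarithms, `x log (1+x²)` is at most `x²/4` plus a linear term, while `x² log 2`
exceeds `x²/2`. The remaining `x²/4` and a constant absorb all linear terms, including `-x log r`.
-/
theorem exists_exp_mul_rpow_le (r : ℝ) : ∃ M : ℝ, 0 < r → ∀ x : ℝ, 0 ≤ x →
    Real.exp (2 * r) * (1 + x ^ 2) ^ x ≤ M * r ^ x * (2 : ℝ) ^ (x ^ 2) := by
  -- The linear coefficient to absorb is `17/4 + |log r| ≤ b`, and `b x ≤ x²/4 + b²` by completing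
  -- the square.
  set b : ℝ := 7 + |Real.log r|
  refine ⟨Real.exp (2 * r + b ^ 2), fun hr x hx => ?_⟩
  rw [Real.rpow_def_of_pos (by positivity), Real.rpow_def_of_pos hr,
    Real.rpow_def_of_pos (by norm_num : (0 : ℝ) < 2), ← Real.exp_add, ← Real.exp_add,
    ← Real.exp_add, Real.exp_le_exp]
  have h1 : Real.log (1 + x ^ 2) ≤ 2 * Real.log (1 + x) := by
    rw [← Real.log_rpow (by positivity)]
    refine Real.log_le_log (by positivity) ?_
    norm_num
    nlinarith
  have h2 : Real.log (1 + x) ≤ (1 + x) / 8 + 2 := by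
    -- The tangent of the logarithm at `8` has slope `1/8`; doubled, it stays below `log 2` with
    -- room to spare.
    have h3 := Real.log_le_sub_one_of_pos (x := (1 + x) / 8) (by positivity)
    have h4 : Real.log 8 = 3 * Real.log 2 := by
      rw [show (8 : ℝ) = 2 ^ 3 by norm_num, Real.log_pow]; norm_num
    rw [Real.log_div (by positivity) (by norm_num), h4] at h3
    linarith [Real.log_two_lt_d9]
  have h3 := Real.log_two_gt_d9
  have h4 : -|Real.log r| ≤ Real.log r := neg_abs_le _
  have h5 : Real.log (1 + x ^ 2) * x ≤ ((1 + x) / 4 + 4) * x := by gcongr; linarith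
  have h6 : -|Real.log r| * x ≤ Real.log r * x := by gcongr
  have h7 : 1 / 2 * x ^ 2 ≤ Real.log 2 * x ^ 2 := by gcongr; linarith
  have h8 : 0 ≤ (x / 2 - b) ^ 2 := sq_nonneg _
  have h9 : b * x = 7 * x + |Real.log r| * x := by ring
  nlinarith

end Fock

end

theorem mainTheorem7 (Z : Type*) [NormedAddCommGroup Z] [InnerProductSpace ℂ Z] [CompleteSpace Z]
    [TopologicalSpace.SeparableSpace Z] :
    ∃ M : ℝ → ℝ, ∀ (z : ℂ) (u : Z) (ε : ℝ), 0 ≤ z.re → u ≠ 0 → 0 < ε → ε ≤ 1 →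
      Fock.IsUnitaryGroup (Fock.segal ε u) (Fock.unitaryGroup (Fock.segal ε u)) ∧
      (∀ ψ ∈ (Fock.numberPow Z z).domain, Fock.weyl ε u ψ ∈ (Fock.numberPow Z z).domain) ∧
      ∃ T : Fock.FockSpace Z →L[ℂ] Fock.FockSpace Z,
        (∀ χ, ∃ η, (χ, η) ∈ (Fock.numberPow Z (-z)).graph ∧
          (Fock.weyl ε u η, T χ) ∈ (Fock.numberPow Z z).graph) ∧
        ‖T‖ ≤ M ‖u‖ * ‖u‖ ^ z.re * (2 : ℝ) ^ (z.re ^ 2) := by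
  -- Positivity of `r` sits inside the existential, so the choice yields `M` on all of `ℝ`, before
  -- `z` and `ε` are introduced.
  choose M hM using Fock.exists_exp_mul_rpow_le
  refine ⟨M, fun z u ε hz hu hε hε1 => ⟨Fock.isUnitaryGroup_segal hε.le u,
    fun ψ hψ => Fock.weyl_mem_domain_numberPow hz hε.le hε1 u hψ,
    Fock.conjWeyl hz hε.le hε1 u, fun χ => ⟨Fock.numberPowNeg hz χ,
      Fock.mk_numberPowNeg_mem_graph hz χ, Fock.mk_conjWeyl_mem_graph hz hε.le hε1 u χ⟩,
    (Fock.norm_conjWeyl_le hz hε.le hε1 u).trans (hM ‖u‖ (norm_pos_iff.mpr hu) z.re hz)⟩⟩
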